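/- Let $d\ge 0$ be an integer and let $P_2(\mathbb R^d)$ be the set of Borel probability measures on $\mathbb R^d$ with finite second moment. For $\mu,\nu\in P_2(\mathbb R^d)$ write $\mathcal T_2(\mu,\nu)=\inf_{\pi\in\Pi(\mu,\nu)}\int|x-y|^2\,d\pi(x,y)$, where $\Pi(\mu,\nu)$ is the set of couplings of $\mu$ and $\nu$, and write $\mu\le_{\mathrm{cx}}\nu$ if $\int\varphi\,d\mu\le\int\varphi\,d\nu$ for every convex $\varphi:\mathbb R^d\to\mathbb R$ for which both integrals exist in the extended sense. Let $\mathcal A_{\mathrm{cx}}$ be the set of proper lower semicontinuous convex functions $\varphi:\mathbb R^d\to\mathbb R\cup\{+\infty\}$, and let $\mathrm S_{b,2}$ be the set of measurable functions $f$ on $\mathbb R^d$ such that $|f(x)|\le C(1+|x|^2)$ for all $x$ and some constant $C$. Put $$Q_2(\varphi)(x)=\inf_{y\in\mathbb R^d}\{\varphi(y)+|x-y|^2\},\qquad Q_{\bar 2}(\varphi)(y)=\sup_{x\in\mathbb R^d}\{\varphi(x)-|x-y|^2\}.$$ The forward and backward convex order projection costs are $$\mathcal T_2(\mathrm P^{\mathrm{cx}}_{2,\mu\le},\nu)=\inf\{\mathcal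 T_2(\xi,\nu):\xi\in P_2(\mathbb R^d),\ \mu\le_{\mathrm{cx}}\xi\},\qquad \mathcal T_2(\mu,\mathrm P^{\mathrm{cx}}_{2,\le\nu})=\inf\{\mathcal T_2(\mu,\eta):\eta\in P_2(\mathbb R^d),\ \eta\le_{\mathrm{cx}}\nu\},$$ and the corresponding dual values are $$\mathcal D_2(\mathrm P^{\mathrm{cx}}_{2,\mu\le},\nu)=\sup_{\varphi\in\mathcal A_{\mathrm{cx}}\cap \mathrm S_{b,2}}\Big\{\int\varphi\,d\mu-\int Q_{\bar 2}(\varphi)\,d\nu\Big\},\qquad \mathcal D_2(\mu,\mathrm P^{\mathrm{cx}}_{2,\le\nu})=\sup_{\varphi\in\mathcal A_{\mathrm{cx}}\cap \mathrm S_{b,2}}\Big\{\int Q_2(\varphi)\,d\mu-\int\varphi\,d\nu\Big\}.$$ A forward dual optimizer is a function $\varphi\in\mathcal A_{\mathrm{cx}}\cap\mathrm S_{b,2}$ with $\int\varphi\,d\mu-\int Q_{\bar 2}(\varphi)\,d\nu=\mathcal D_2(\mathrm P^{\mathrm{cx}}_{2,\mu\le},\nu)$. A backward dual optimizer is a function $\varphi\in\mathcal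 A_{\mathrm{cx}}\cap L^1(d\nu)$ with $\int Q_2(\varphi)\,d\mu-\int\varphi\,d\nu=\mathcal D_2(\mu,\mathrm P^{\mathrm{cx}}_{2,\le\nu})$. **Theorem.** Let $\mu,\nu\in P_2(\mathbb R^d)$. Then $$\mathcal T_2(\mathrm P^{\mathrm{cx}}_{2,\mu\le},\nu)=\mathcal D_2(\mathrm P^{\mathrm{cx}}_{2,\mu\le},\nu)=\mathcal D_2(\mu,\mathrm P^{\mathrm{cx}}_{2,\le\nu})=\mathcal T_2(\mu,\mathrm P^{\mathrm{cx}}_{2,\le\nu}).$$ Moreover: (i) if $\varphi^f$ is a forward dual optimizer, then $Q_{\bar 2}(\varphi^f)$ belongs to $\mathcal A_{\mathrm{cx}}\cap L^1(d\nu)$ and is a backward dual optimizer; (ii) if $\varphi^b$ is a backward dual optimizer, then $Q_2(\varphi^b)$ belongs to $\mathcal A_{\mathrm{cx}}\cap\mathrm S_{b,2}$ and is a forward dual optimizer. -/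

import Mathlib

open MeasureTheory
open scoped ENNReal

noncomputable section

namespace ConvexOrderProjection

/-- The Euclidean space `ℝ^d`. -/
abbrev E (d : ℕ) : Type := EuclideanSpace ℝ (Fin d)

/-! ### Probability measures with finite second moment, transport cost -/

/-- `P₂(ℝ^d)`: Borel probability measures on `ℝ^d` with finite second moment. -/
def P2 (d : ℕ) : Set (Measure (E d)) :=
  {μ | IsProbabilityMeasure μ ∧ ∫⁻ x, ENNReal.ofReal (‖x‖ ^ 2) ∂μ < ∞}

/-- Couplings of `μ` and `ν` (automatically probability measures if `μ` is one). -/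
def couplings {d : ℕ} (μ ν : Measure (E d)) : Set (Measure (E d × E d)) :=
  {π | π.map Prod.fst = μ ∧ π.map Prod.snd = ν}

/-- The quadratic transport cost `𝒯₂(μ, ν)`. -/
def transportCost {d : ℕ} (μ ν : Measure (E d)) : ℝ≥0∞ :=
  ⨅ π ∈ couplings μ ν, ∫⁻ p, ENNReal.ofReal (‖p.1 - p.2‖ ^ 2) ∂π

/-! ### Integrals of extended-real-valued functions -/

/-- The integral of `f` exists in the extended sense: its positive part or its negative part
has finite integral. -/
def IntegralExists {d : ℕ} (μ : Measure (E d)) (f : E d → EReal) : Prop :=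
  AEMeasurable f μ ∧
    (∫⁻ x, (f x).toENNReal ∂μ < ∞ ∨ ∫⁻ x, (-f x).toENNReal ∂μ < ∞)

/-- The extended integral `∫ f⁺ dμ - ∫ f⁻ dμ`, meaningful when `IntegralExists μ f`. -/
def eIntegral {d : ℕ} (μ : Measure (E d)) (f : E d → EReal) : EReal :=
  ((∫⁻ x, (f x).toENNReal ∂μ : ℝ≥0∞) : EReal) - ((∫⁻ x, (-f x).toENNReal ∂μ : ℝ≥0∞) : EReal)

/-- `L¹(dμ)` for extended-real-valued functions. -/
def L1 {d : ℕ} (μ : Measure (E d)) : Set (E d → EReal) :=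
  {f | AEMeasurable f μ ∧ ∫⁻ x, (f x).toENNReal ∂μ < ∞ ∧ ∫⁻ x, (-f x).toENNReal ∂μ < ∞}

/-! ### Convex order and the two cones -/

/-- Convex order: `∫ φ dμ ≤ ∫ φ dν` for every real-valued convex `φ` for which both integrals
exist in the extended sense. -/
def ConvexOrder {d : ℕ} (μ ν : Measure (E d)) : Prop :=
  ∀ φ : E d → ℝ, ConvexOn ℝ Set.univ φ →
    IntegralExists μ (fun x => (φ x : EReal)) → IntegralExists ν (fun x => (φ x : EReal)) →
      eIntegral μ (fun x => (φ x : EReal)) ≤ eIntegral ν (fun x => (φ x : EReal))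

/-- The backward cone with vertex `ν`. -/
def backwardCone {d : ℕ} (ν : Measure (E d)) : Set (Measure (E d)) :=
  {η | η ∈ P2 d ∧ ConvexOrder η ν}

/-- The forward cone with vertex `μ`. -/
def forwardCone {d : ℕ} (μ : Measure (E d)) : Set (Measure (E d)) :=
  {ξ | ξ ∈ P2 d ∧ ConvexOrder μ ξ}

/-- The backward projection cost `inf {𝒯₂(μ, η) : η ∈ P₂, η ≤_cx ν}`. -/
def backwardCost {d : ℕ} (μ ν : Measure (E d)) : ℝ≥0∞ :=
  ⨅ η ∈ backwardCone ν, transportCost μ η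

/-- The forward projection cost `inf {𝒯₂(ξ, ν) : ξ ∈ P₂, μ ≤_cx ξ}`. -/
def forwardCost {d : ℕ} (μ ν : Measure (E d)) : ℝ≥0∞ :=
  ⨅ ξ ∈ forwardCone μ, transportCost ξ ν

/-! ### Function classes and quadratic transforms -/

/-- Proper lower semicontinuous convex functions `ℝ^d → ℝ ∪ {+∞}`; convexity is convexity of the
epigraph. -/
def Acx (d : ℕ) : Set (E d → EReal) :=
  {φ | Convex ℝ {p : E d × ℝ | φ p.1 ≤ (p.2 : EReal)} ∧ LowerSemicontinuous φ ∧
    (∀ x, φ x ≠ ⊥) ∧ ∃ x, φ x ≠ ⊤}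

/-- Measurable functions of at most quadratic growth: `|f(x)| ≤ C (1 + |x|²)`. -/
def Sb2 (d : ℕ) : Set (E d → EReal) :=
  {f | Measurable f ∧ ∃ C : ℝ, ∀ x,
    ((-(C * (1 + ‖x‖ ^ 2)) : ℝ) : EReal) ≤ f x ∧ f x ≤ ((C * (1 + ‖x‖ ^ 2) : ℝ) : EReal)}

/-- `Q₂(φ)(x) = inf_y {φ(y) + |x - y|²}`. -/
def Q2 {d : ℕ} (φ : E d → EReal) (x : E d) : EReal :=
  ⨅ y : E d, (φ y + ((‖x - y‖ ^ 2 : ℝ) : EReal))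

/-- `Q_{2̄}(φ)(y) = sup_x {φ(x) - |x - y|²}`. -/
def Q2bar {d : ℕ} (φ : E d → EReal) (y : E d) : EReal :=
  ⨆ x : E d, (φ x - ((‖x - y‖ ^ 2 : ℝ) : EReal))

/-! ### Dual problems -/

/-- The backward dual functional `∫ Q₂(φ) dμ - ∫ φ dν`. -/
def backwardFunctional {d : ℕ} (μ ν : Measure (E d)) (φ : E d → EReal) : EReal :=
  eIntegral μ (Q2 φ) - eIntegral ν φ

/-- The forward dual functional `∫ φ dμ - ∫ Q_{2̄}(φ) dν`. -/
def forwardFunctional {d : ℕ} (μ ν : Measure (E d)) (φ : E d → EReal) : EReal :=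
  eIntegral μ φ - eIntegral ν (Q2bar φ)

/-- The backward dual value. -/
def backwardDual {d : ℕ} (μ ν : Measure (E d)) : EReal :=
  ⨆ φ ∈ Acx d ∩ Sb2 d, backwardFunctional μ ν φ

/-- The forward dual value. -/
def forwardDual {d : ℕ} (μ ν : Measure (E d)) : EReal :=
  ⨆ φ ∈ Acx d ∩ Sb2 d, forwardFunctional μ ν φ

/-- A backward dual optimizer: a function in `Acx ∩ L¹(dν)`, possibly taking the value `+∞` and
not necessarily of quadratic growth, at which the backward dual value is achieved. -/
def IsBackwardDualOptimizer {d : ℕ} (μ ν : Measure (E d)) (φ : E d → EReal) : Prop :=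
  φ ∈ Acx d ∩ L1 ν ∧ backwardFunctional μ ν φ = backwardDual μ ν

/-- A forward dual optimizer: a function in `Acx ∩ Sb2` at which the forward dual value is
achieved. (Such functions are real-valued and convex, hence continuous.) -/
def IsForwardDualOptimizer {d : ℕ} (μ ν : Measure (E d)) (φ : E d → EReal) : Prop :=
  φ ∈ Acx d ∩ Sb2 d ∧ forwardFunctional μ ν φ = forwardDual μ ν

end ConvexOrderProjection

end

open ConvexOrderProjection

/-! The four values are equal because they lie on a closed chain of inequalities: each cost ≤
backward dual ≤ forward dual ≤ each cost.

The dual problems are linked by `φ ≤ Q2 (Q2bar φ)` and `Q2bar (Q2 φ) ≤ φ`: neither transform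
decreases the dual functional on passing to the other problem. The same inequalities carry
optimizers across.

Weak duality integrates the transform inequality along couplings. In the backward case `φ` may be
infinite and need not be integrable against `η`, so it is replaced by Moreau envelopes with
coefficient `1 + 1/ε` (`Q2_le_moreau_add`), at the price of a factor `1 + ε` in the cost.

For strong duality, `μ` and `ν` are split into finitely many pieces of small mean variance, with
barycentres `s i` and `t j`. This leaves the finite problem of minimizing `∑ m i |s i - ∑ q i j t
j|²` over couplings. An exact coupling gives competitors for both projections with the same cost
(`backwardCost_le`, `forwardCost_le`). Penalizing the column constraint gives multipliers
(`exists_coupling_multipliers`), from which a maximum of affine functions is built as a nearly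
optimal dual function (`le_backwardDual`). -/

namespace ConvexOrderProjection

variable {d : ℕ}

/-! ### Extended integrals -/

lemma eIntegral_coe {μ : Measure (E d)} {f : E d → ℝ} (hf : Integrable f μ) :
    eIntegral μ (fun x => (f x : EReal)) = ((∫ x, f x ∂μ : ℝ) : EReal) := by
  have h1 : ∫⁻ x, ENNReal.ofReal (f x) ∂μ ≠ ∞ := hf.lintegral_lt_top.ne
  have h2 : ∫⁻ x, ENNReal.ofReal (-f x) ∂μ ≠ ∞ := hf.neg.lintegral_lt_top.ne
  rw [integral_eq_lintegral_pos_part_sub_lintegral_neg_part hf, EReal.coe_sub,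
    EReal.coe_ennreal_toReal h1, EReal.coe_ennreal_toReal h2]
  rfl

lemma eIntegral_congr_ae {μ : Measure (E d)} {f g : E d → EReal} (h : f =ᵐ[μ] g) :
    eIntegral μ f = eIntegral μ g := by
  have h1 : ∫⁻ x, (f x).toENNReal ∂μ = ∫⁻ x, (g x).toENNReal ∂μ :=
    lintegral_congr_ae (h.mono fun x hx => by simp only [hx])
  have h2 : ∫⁻ x, (-f x).toENNReal ∂μ = ∫⁻ x, (-g x).toENNReal ∂μ :=
    lintegral_congr_ae (h.mono fun x hx => by simp only [hx])
  rw [eIntegral, eIntegral, h1, h2]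

lemma ae_eq_coe_toReal_of_mem_L1 {μ : Measure (E d)} {φ : E d → EReal} (h : φ ∈ L1 μ) :
    φ =ᵐ[μ] fun x => ((φ x).toReal : EReal) := by
  obtain ⟨hm, h1, h2⟩ := h
  have a1 := ae_lt_top' hm.ereal_toENNReal h1.ne
  have a2 := ae_lt_top' hm.neg.ereal_toENNReal h2.ne
  filter_upwards [a1, a2] with x h1 h2
  have h1' : φ x ≠ ⊤ := fun h => by simp [h] at h1
  have h2' : φ x ≠ ⊥ := fun h => by simp [h] at h2
  exact (EReal.coe_toReal h1' h2').symm

lemma integrable_toReal_of_mem_L1 {μ : Measure (E d)} {φ : E d → EReal} (h : φ ∈ L1 μ) :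
    Integrable (fun x => (φ x).toReal) μ := by
  have hae := ae_eq_coe_toReal_of_mem_L1 h
  obtain ⟨hm, h1, h2⟩ := h
  refine ⟨(measurable_ereal_toReal.comp_aemeasurable hm).aestronglyMeasurable, ?_⟩
  rw [hasFiniteIntegral_iff_norm]
  have : ∀ᵐ x ∂μ, ENNReal.ofReal ‖(φ x).toReal‖ = (φ x).toENNReal + (-φ x).toENNReal := by
    filter_upwards [hae] with x hx
    rw [hx, EReal.toReal_coe, ← EReal.coe_neg, EReal.real_coe_toENNReal, EReal.real_coe_toENNReal,
      Real.norm_eq_abs]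
    rcases le_total 0 (φ x).toReal with h | h
    · rw [abs_of_nonneg h, ENNReal.ofReal_of_nonpos (neg_nonpos.2 h), add_zero]
    · rw [abs_of_nonpos h, ENNReal.ofReal_of_nonpos h, zero_add]
  rw [lintegral_congr_ae this, lintegral_add_left' hm.ereal_toENNReal]
  exact ENNReal.add_lt_top.2 ⟨h1, h2⟩

lemma eIntegral_of_mem_L1 {μ : Measure (E d)} {φ : E d → EReal} (h : φ ∈ L1 μ) :
    eIntegral μ φ = ((∫ x, (φ x).toReal ∂μ : ℝ) : EReal) := by
  rw [eIntegral_congr_ae (ae_eq_coe_toReal_of_mem_L1 h),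
    eIntegral_coe (integrable_toReal_of_mem_L1 h)]

lemma coe_mem_L1 {μ : Measure (E d)} {f : E d → ℝ} (hf : Integrable f μ) :
    (fun x => (f x : EReal)) ∈ L1 μ :=
  ⟨hf.aemeasurable.coe_real_ereal, hf.lintegral_lt_top, hf.neg.lintegral_lt_top⟩

lemma integralExists_coe {μ : Measure (E d)} {f : E d → ℝ} (hf : Integrable f μ) :
    IntegralExists μ (fun x => (f x : EReal)) :=
  ⟨hf.aemeasurable.coe_real_ereal, Or.inl hf.lintegral_lt_top⟩

lemma mem_L1_of_eIntegral {μ : Measure (E d)} {φ : E d → EReal} (hm : AEMeasurable φ μ)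
    (h1 : eIntegral μ φ ≠ ⊤) (h2 : eIntegral μ φ ≠ ⊥) : φ ∈ L1 μ := by
  have hneg : ∫⁻ x, (-φ x).toENNReal ∂μ ≠ ∞ := by
    intro h
    apply h2
    rw [eIntegral, h, EReal.coe_ennreal_top, EReal.sub_top]
  refine ⟨hm, lt_top_iff_ne_top.2 fun h => h1 ?_, lt_top_iff_ne_top.2 hneg⟩
  rw [eIntegral, h, EReal.coe_ennreal_top, EReal.top_sub]
  exact fun h => hneg (EReal.coe_ennreal_eq_top_iff.1 h)

lemma ConvexOrder.integral_le {μ ν : Measure (E d)} (h : ConvexOrder μ ν) {f : E d → ℝ}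
    (hf : ConvexOn ℝ Set.univ f) (h1 : Integrable f μ) (h2 : Integrable f ν) :
    ∫ x, f x ∂μ ≤ ∫ x, f x ∂ν := by
  have := h f hf (integralExists_coe h1) (integralExists_coe h2)
  rwa [eIntegral_coe h1, eIntegral_coe h2, EReal.coe_le_coe_iff] at this

/-! ### Functions of quadratic growth -/

lemma P2.integrable_sq_norm {μ : Measure (E d)} (hμ : μ ∈ P2 d) :
    Integrable (fun x => ‖x‖ ^ 2) μ := by
  refine ⟨by fun_prop, ?_⟩
  rw [hasFiniteIntegral_iff_ofReal (Filter.Eventually.of_forall fun x => by positivity)]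
  exact hμ.2

lemma P2.integrable_of_abs_le {μ : Measure (E d)} (hμ : μ ∈ P2 d) {f : E d → ℝ}
    (hf : AEStronglyMeasurable f μ) {C : ℝ} (h : ∀ x, |f x| ≤ C * (1 + ‖x‖ ^ 2)) :
    Integrable f μ := by
  have := hμ.1
  exact (((integrable_const (1 : ℝ)).add (P2.integrable_sq_norm hμ)).const_mul C).mono' hf
    (Filter.Eventually.of_forall h)

lemma continuous_of_convexOn {f : E d → ℝ} (hf : ConvexOn ℝ Set.univ f) : Continuous f :=
  hf.locallyLipschitz.continuous

lemma P2.integrable_of_convexOn {μ : Measure (E d)} (hμ : μ ∈ P2 d) {f : E d → ℝ}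
    (hf : ConvexOn ℝ Set.univ f) {C : ℝ} (h : ∀ x, |f x| ≤ C * (1 + ‖x‖ ^ 2)) :
    Integrable f μ :=
  P2.integrable_of_abs_le hμ (continuous_of_convexOn hf).aestronglyMeasurable h

lemma coe_mem_Acx {f : E d → ℝ} (hf : ConvexOn ℝ Set.univ f) :
    (fun x => (f x : EReal)) ∈ Acx d := by
  refine ⟨?_, (continuous_coe_real_ereal.comp
    (continuous_of_convexOn hf)).lowerSemicontinuous, fun x => EReal.coe_ne_bot _,
    0, EReal.coe_ne_top _⟩
  simpa using hf.convex_epigraph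

lemma coe_mem_Sb2 {f : E d → ℝ} (hf : ConvexOn ℝ Set.univ f) {C : ℝ}
    (h : ∀ x, |f x| ≤ C * (1 + ‖x‖ ^ 2)) : (fun x => (f x : EReal)) ∈ Sb2 d := by
  refine ⟨(continuous_of_convexOn hf).measurable.coe_real_ereal, C, fun x => ?_⟩
  rw [EReal.coe_le_coe_iff, EReal.coe_le_coe_iff]
  exact abs_le.1 (h x)

lemma exists_convexOn_of_mem_Acx_Sb2 {φ : E d → EReal} (h : φ ∈ Acx d ∩ Sb2 d) :
    ∃ f : E d → ℝ, φ = (fun x => (f x : EReal)) ∧ ConvexOn ℝ Set.univ f ∧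
      ∃ C : ℝ, ∀ x, |f x| ≤ C * (1 + ‖x‖ ^ 2) := by
  obtain ⟨⟨hc, -, -, -⟩, -, C, hC⟩ := h
  have hφ : ∀ x, φ x = ((φ x).toReal : EReal) := fun x =>
    (EReal.coe_toReal (ne_top_of_le_ne_top (EReal.coe_ne_top _) (hC x).2)
      (ne_bot_of_le_ne_bot (EReal.coe_ne_bot _) (hC x).1)).symm
  refine ⟨fun x => (φ x).toReal, funext hφ, ?_, C, fun x => ?_⟩
  · rw [convexOn_iff_convex_epigraph]
    convert hc using 3 with p
    simp only [Set.mem_univ, true_and]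
    conv_rhs => rw [hφ]
    exact EReal.coe_le_coe_iff.symm
  · have := hC x
    rw [hφ x, EReal.coe_le_coe_iff, EReal.coe_le_coe_iff] at this
    exact abs_le.2 this

/-! ### Moreau envelopes -/

/-- Hahn-Banach separates a point below the graph from the closed epigraph. The hyperplane is not
vertical, since it also separates two points on one vertical line. -/
lemma exists_affine_le_of_mem_Acx {φ : E d → EReal} (h : φ ∈ Acx d) :
    ∃ (a : E d) (c : ℝ), ∀ x, ((inner ℝ a x + c : ℝ) : EReal) ≤ φ x := by
  obtain ⟨hc, hl, hb, x₀, hx₀⟩ := h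
  obtain ⟨r₀, hr₀⟩ : ∃ r₀ : ℝ, φ x₀ = r₀ := ⟨_, (EReal.coe_toReal hx₀ (hb x₀)).symm⟩
  have hclosed : IsClosed {p : E d × ℝ | φ p.1 ≤ (p.2 : EReal)} := by
    have := hl.isClosed_epigraph
    exact this.preimage (f := fun p : E d × ℝ => (p.1, (p.2 : EReal)))
      (continuous_fst.prodMk (continuous_coe_real_ereal.comp continuous_snd))
  have hnot : (x₀, r₀ - 1) ∉ {p : E d × ℝ | φ p.1 ≤ (p.2 : EReal)} := by
    simp only [Set.mem_ofPred_eq, hr₀, EReal.coe_le_coe_iff]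
    linarith
  obtain ⟨f, u, hu, hf⟩ := geometric_hahn_banach_point_closed hc hclosed hnot
  have hsplit : ∀ x t, f (x, t) = f (x, 0) + t * f (0, 1) := fun x t => by
    have : ((x, t) : E d × ℝ) = (x, 0) + t • (0, 1) := by simp
    rw [this, map_add, map_smul, smul_eq_mul]
  set c := f (0, 1) with hcdef
  have hcpos : 0 < c := by
    have h1 := hf (x₀, r₀) hr₀.le
    rw [hsplit] at h1 hu
    linarith
  let g : E d →L[ℝ] ℝ := f.comp (ContinuousLinearMap.inl ℝ (E d) ℝ)
  let a := (InnerProductSpace.toDual ℝ (E d)).symm g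
  have ha : ∀ x, inner ℝ a x = f (x, 0) := fun x => by
    simp [a, InnerProductSpace.toDual_symm_apply, g]
  refine ⟨-(1 / c) • a, u / c, fun x => ?_⟩
  by_cases hx : φ x = ⊤
  · rw [hx]; exact le_top
  obtain ⟨r, hr⟩ : ∃ r : ℝ, φ x = r := ⟨_, (EReal.coe_toReal hx (hb x)).symm⟩
  have h1 := hf (x, r) hr.le
  rw [hsplit] at h1
  rw [hr, EReal.coe_le_coe_iff, inner_smul_left, ha]
  simp only [conj_trivial]
  have : -(1 / c) * f (x, 0) + u / c = (u - f (x, 0)) / c := by ring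
  rw [this, div_le_iff₀ hcpos]
  linarith

/-- The Moreau envelope `inf_y {φ(y) + k |x - y|²}`. -/
noncomputable def moreau (k : ℝ) (φ : E d → EReal) (x : E d) : EReal :=
  ⨅ y : E d, (φ y + ((k * ‖x - y‖ ^ 2 : ℝ) : EReal))

lemma Q2_eq_moreau (φ : E d → EReal) : Q2 φ = moreau 1 φ := by
  funext x; simp [Q2, moreau]

lemma moreau_le {k : ℝ} {φ : E d → EReal} (x y : E d) :
    moreau k φ x ≤ φ y + ((k * ‖x - y‖ ^ 2 : ℝ) : EReal) := iInf_le _ y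

lemma moreau_le_self (k : ℝ) (φ : E d → EReal) (x : E d) : moreau k φ x ≤ φ x := by
  simpa using moreau_le (k := k) (φ := φ) x x

lemma sq_norm_sub_le (x y : E d) : ‖x - y‖ ^ 2 ≤ 2 * ‖x‖ ^ 2 + 2 * ‖y‖ ^ 2 := by
  have := parallelogram_law_with_norm ℝ x y
  nlinarith [mul_self_nonneg ‖x + y‖]

lemma inner_le_mul_sq_add (a u : E d) {k : ℝ} (hk : 0 < k) :
    inner ℝ a u ≤ k * ‖u‖ ^ 2 + ‖a‖ ^ 2 / (4 * k) := by
  have h := sq_nonneg ‖(2 * k) • u - a‖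
  rw [norm_sub_sq_real, norm_smul, inner_smul_left, real_inner_comm] at h
  have : k * ‖u‖ ^ 2 + ‖a‖ ^ 2 / (4 * k) - inner ℝ a u =
      (4 * k ^ 2 * ‖u‖ ^ 2 + ‖a‖ ^ 2 - 4 * k * inner ℝ a u) / (4 * k) := by
    field_simp
  have h2 : 0 ≤ (4 * k ^ 2 * ‖u‖ ^ 2 + ‖a‖ ^ 2 - 4 * k * inner ℝ a u) / (4 * k) := by
    apply div_nonneg _ (by positivity)
    simp only [Real.norm_eq_abs, mul_pow, sq_abs, conj_trivial] at h
    linarith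
  linarith

/-- One finite value of `φ` bounds the envelope above, and an affine minorant bounds it below by
completing the square. Convexity is that of a partial infimum of a jointly convex function. -/
lemma exists_moreau_eq_coe {φ : E d → EReal} (h : φ ∈ Acx d) {k : ℝ} (hk : 0 < k) :
    ∃ m : E d → ℝ, moreau k φ = (fun x => (m x : EReal)) ∧ ConvexOn ℝ Set.univ m ∧
      ∃ C : ℝ, ∀ x, |m x| ≤ C * (1 + ‖x‖ ^ 2) := by
  obtain ⟨a, c, hac⟩ := exists_affine_le_of_mem_Acx h
  obtain ⟨hc, hl, hb, y₀, hy₀⟩ := h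
  obtain ⟨r₀, hr₀⟩ : ∃ r₀ : ℝ, φ y₀ = r₀ := ⟨_, (EReal.coe_toReal hy₀ (hb y₀)).symm⟩
  have hup : ∀ x, moreau k φ x ≤ ((r₀ + k * ‖x - y₀‖ ^ 2 : ℝ) : EReal) := fun x => by
    have := moreau_le (k := k) (φ := φ) x y₀
    rwa [hr₀, ← EReal.coe_add] at this
  have hlo : ∀ x, ((inner ℝ a x + c - ‖a‖ ^ 2 / (4 * k) : ℝ) : EReal) ≤ moreau k φ x := by
    refine fun x => le_iInf fun y => ?_
    refine le_trans ?_ (add_le_add_left (hac y) _)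
    rw [← EReal.coe_add, EReal.coe_le_coe_iff]
    have := inner_le_mul_sq_add a (x - y) hk
    rw [inner_sub_right] at this
    linarith
  have hm : ∀ x, moreau k φ x = ((moreau k φ x).toReal : EReal) := fun x =>
    (EReal.coe_toReal (ne_top_of_le_ne_top (EReal.coe_ne_top _) (hup x))
      (ne_bot_of_le_ne_bot (EReal.coe_ne_bot _) (hlo x))).symm
  generalize hM : (fun x => (moreau k φ x).toReal) = m
  have hm' : ∀ x, moreau k φ x = m x := fun x => by rw [hm x, ← hM]
  -- Near-minimizers suffice, so attainment of the infimum is not needed.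
  have key : ∀ x (ε : ℝ), 0 < ε → ∃ y r, φ y ≤ ((r : ℝ) : EReal) ∧ r + k * ‖x - y‖ ^ 2 < m x + ε := by
    intro x ε hε
    have : moreau k φ x < ((m x + ε : ℝ) : EReal) := by
      rw [hm' x, EReal.coe_lt_coe_iff]; linarith
    obtain ⟨y, hy⟩ := iInf_lt_iff.1 this
    have hyt : φ y ≠ ⊤ := fun h => by
      rw [h, EReal.top_add_coe] at hy
      exact not_top_lt hy
    refine ⟨y, (φ y).toReal, (EReal.coe_toReal hyt (hb y)).ge, ?_⟩
    rw [← EReal.coe_toReal hyt (hb y), ← EReal.coe_add, EReal.coe_lt_coe_iff] at hy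
    exact hy
  refine ⟨m, funext hm', ⟨convex_univ, fun x _ x' _ α β hα hβ hαβ => ?_⟩, ?_⟩
  · refine le_of_forall_pos_le_add fun ε hε => ?_
    obtain ⟨y, r, hy, hr⟩ := key x ε hε
    obtain ⟨y', r', hy', hr'⟩ := key x' ε hε
    have hepi := hc (x := (y, r)) hy (y := (y', r')) hy' hα hβ hαβ
    have h1 := moreau_le (k := k) (φ := φ) (α • x + β • x') (α • y + β • y')
    have h2 := h1.trans (add_le_add_left hepi _)
    rw [hm', ← EReal.coe_add, EReal.coe_le_coe_iff] at h2
    have h3 : ‖α • x + β • x' - (α • y + β • y')‖ ^ 2 ≤ α * ‖x - y‖ ^ 2 + β * ‖x' - y'‖ ^ 2 := by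
      have e : α • x + β • x' - (α • y + β • y') = α • (x - y) + β • (x' - y') := by
        module
      rw [e]
      exact ((convexOn_norm (convex_univ (𝕜 := ℝ) (E := E d))).pow (fun _ _ => norm_nonneg _) 2).2
        (Set.mem_univ _) (Set.mem_univ _) hα hβ hαβ
    simp only [Prod.smul_mk, Prod.mk_add_mk, smul_eq_mul] at h2 ⊢
    have e : ε = α * ε + β * ε := by rw [← add_mul, hαβ, one_mul]
    nlinarith [mul_le_mul_of_nonneg_left h3 hk.le, mul_le_mul_of_nonneg_left hr.le hα,
      mul_le_mul_of_nonneg_left hr'.le hβ]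
  · refine ⟨|r₀| + 2 * k + 2 * k * ‖y₀‖ ^ 2 + ‖a‖ ^ 2 + 1 + |c| + ‖a‖ ^ 2 / (4 * k), fun x => ?_⟩
    have h1 := hup x
    have h2 := hlo x
    rw [hm', EReal.coe_le_coe_iff] at h1 h2
    have h3 := sq_norm_sub_le x y₀
    have h4 := abs_real_inner_le_norm a x
    have h5 := le_abs_self r₀
    have h6 := neg_abs_le c
    have h7 := (abs_le.1 h4).1
    have h8 : 0 ≤ ‖a‖ ^ 2 / (4 * k) := by positivity
    have h9 := sq_nonneg (‖a‖ - ‖x‖)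
    have hx := sq_nonneg ‖x‖
    have h10 : 0 ≤ (|r₀| + 2 * k * ‖y₀‖ ^ 2 + ‖a‖ ^ 2 + |c| + ‖a‖ ^ 2 / (4 * k)) * ‖x‖ ^ 2 := by
      positivity
    rw [abs_le]
    constructor
    · nlinarith [sq_nonneg ‖a‖, abs_nonneg r₀, mul_nonneg hk.le (sq_nonneg ‖y₀‖),
        mul_nonneg hk.le hx]
    · nlinarith [sq_nonneg ‖a‖, abs_nonneg c, mul_nonneg hk.le (sq_nonneg ‖y₀‖),
        mul_nonneg hk.le hx, mul_le_mul_of_nonneg_left h3 hk.le]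

lemma Q2_mem {φ : E d → EReal} (h : φ ∈ Acx d) : Q2 φ ∈ Acx d ∩ Sb2 d := by
  obtain ⟨m, hm, hc, C, hC⟩ := exists_moreau_eq_coe h one_pos
  rw [Q2_eq_moreau, hm]
  exact ⟨coe_mem_Acx hc, coe_mem_Sb2 hc hC⟩

lemma mem_L1_of_mem_Acx_Sb2 {μ : Measure (E d)} (hμ : μ ∈ P2 d) {φ : E d → EReal}
    (h : φ ∈ Acx d ∩ Sb2 d) : φ ∈ L1 μ := by
  obtain ⟨f, rfl, hf, C, hC⟩ := exists_convexOn_of_mem_Acx_Sb2 h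
  exact coe_mem_L1 (P2.integrable_of_convexOn hμ hf hC)

/-! ### The transforms `Q₂` and `Q_{2̄}` -/

lemma le_Q2bar (φ : E d → EReal) (y : E d) : φ y ≤ Q2bar φ y := by
  refine le_trans ?_ (le_iSup (fun x : E d => (φ x - ((‖x - y‖ ^ 2 : ℝ) : EReal))) y)
  simp

lemma le_Q2_Q2bar (φ : E d → EReal) (x : E d) : φ x ≤ Q2 (Q2bar φ) x := by
  refine le_iInf fun y => ?_
  have := le_iSup (fun x : E d => (φ x - ((‖x - y‖ ^ 2 : ℝ) : EReal))) x
  exact (EReal.sub_le_iff_le_add (Or.inl (EReal.coe_ne_bot _)) (Or.inl (EReal.coe_ne_top _))).1 this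

lemma Q2bar_Q2_le (φ : E d → EReal) (y : E d) : Q2bar (Q2 φ) y ≤ φ y := by
  refine iSup_le fun x => ?_
  rw [EReal.sub_le_iff_le_add (Or.inl (EReal.coe_ne_bot _)) (Or.inl (EReal.coe_ne_top _))]
  exact iInf_le _ y

lemma lowerSemicontinuous_Q2bar (f : E d → ℝ) :
    LowerSemicontinuous (Q2bar fun x => (f x : EReal)) := by
  refine lowerSemicontinuous_iSup fun x => Continuous.lowerSemicontinuous ?_
  simp_rw [← EReal.coe_sub]
  exact continuous_coe_real_ereal.comp (by fun_prop)

/-- With `x = y + z` the transform is a supremum over `z` of `f (y + z) - |z|²`, convex in `y`.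
Properness must be assumed: for `f` growing faster than `|x|²` the supremum is infinite everywhere.
-/
lemma Q2bar_mem_Acx {φ : E d → EReal} (h : φ ∈ Acx d ∩ Sb2 d) (htop : ∃ y, Q2bar φ y ≠ ⊤) :
    Q2bar φ ∈ Acx d := by
  obtain ⟨f, rfl, hf, C, hC⟩ := exists_convexOn_of_mem_Acx_Sb2 h
  refine ⟨?_, lowerSemicontinuous_Q2bar f, fun x =>
    ne_bot_of_le_ne_bot (EReal.coe_ne_bot (f x)) (le_Q2bar (fun x => (f x : EReal)) x), htop⟩
  have hle : ∀ (y : E d) (r : ℝ), Q2bar (fun x => (f x : EReal)) y ≤ (r : EReal) ↔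
      ∀ z, f (y + z) ≤ r + ‖z‖ ^ 2 := fun y r => by
    rw [Q2bar, iSup_le_iff]
    constructor
    · intro h z
      have := h (y + z)
      rw [← EReal.coe_sub, EReal.coe_le_coe_iff, add_sub_cancel_left] at this
      linarith
    · intro h x
      have := h (x - y)
      rw [add_sub_cancel] at this
      rw [← EReal.coe_sub, EReal.coe_le_coe_iff]
      linarith
  rintro ⟨y, r⟩ h1 ⟨y', r'⟩ h2 α β hα hβ hαβ
  simp only [Set.mem_ofPred_eq, hle, Prod.smul_mk, Prod.mk_add_mk, smul_eq_mul] at h1 h2 ⊢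
  intro z
  have e : α • y + β • y' + z = α • (y + z) + β • (y' + z) := by
    have : z = (α + β) • z := by rw [hαβ, one_smul]
    nth_rewrite 1 [this]
    module
  rw [e]
  have h3 := hf.2 (Set.mem_univ (y + z)) (Set.mem_univ (y' + z)) hα hβ hαβ
  have e2 : ‖z‖ ^ 2 = α * ‖z‖ ^ 2 + β * ‖z‖ ^ 2 := by rw [← add_mul, hαβ, one_mul]
  simp only [smul_eq_mul] at h3
  have h4 := mul_le_mul_of_nonneg_left (h1 z) hα
  have h5 := mul_le_mul_of_nonneg_left (h2 z) hβ
  linarith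

/-! ### Weak duality -/

lemma EReal_le_coe_iff {a : EReal} {x : ℝ≥0∞} : a ≤ (x : EReal) ↔ a.toENNReal ≤ x := by
  constructor
  · intro h
    simpa using EReal.toENNReal_le_toENNReal h
  · intro h
    refine le_trans ?_ (EReal.coe_ennreal_le_coe_ennreal_iff.2 h)
    rw [EReal.coe_toENNReal_eq_max]
    exact le_max_right _ _

/-- No integrability is needed: subtraction in `EReal` stays monotone under the convention `⊤ - ⊤ =
⊥`. -/
lemma eIntegral_mono {μ : Measure (E d)} {φ ψ : E d → EReal} (h : ∀ x, φ x ≤ ψ x) :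
    eIntegral μ φ ≤ eIntegral μ ψ := by
  refine EReal.sub_le_sub (EReal.coe_ennreal_le_coe_ennreal_iff.2 (lintegral_mono fun x =>
    EReal.toENNReal_le_toENNReal (h x))) (EReal.coe_ennreal_le_coe_ennreal_iff.2
      (lintegral_mono fun x => EReal.toENNReal_le_toENNReal (EReal.neg_le_neg_iff.2 (h x))))

lemma le_transportCost_iff {μ ν : Measure (E d)} {a : EReal} :
    a ≤ (transportCost μ ν : EReal) ↔ ∀ π ∈ couplings μ ν,
      a ≤ ((∫⁻ p, ENNReal.ofReal (‖p.1 - p.2‖ ^ 2) ∂π : ℝ≥0∞) : EReal) := by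
  simp only [EReal_le_coe_iff, transportCost, le_iInf_iff]

/-- A real inequality `f(x) ≤ g(y) + c |x - y|²` integrates along couplings. -/
lemma integral_le_of_coupling {μ ν : Measure (E d)} {π : Measure (E d × E d)}
    (hπ : π ∈ couplings μ ν) {f g : E d → ℝ} (hf : Integrable f μ) (hg : Integrable g ν) {c : ℝ}
    (hI : Integrable (fun p : E d × E d => ‖p.1 - p.2‖ ^ 2) π)
    (h : ∀ᵐ p ∂π, f p.1 ≤ g p.2 + c * ‖p.1 - p.2‖ ^ 2) :
    ∫ x, f x ∂μ ≤ ∫ y, g y ∂ν + c * ∫ p, ‖p.1 - p.2‖ ^ 2 ∂π := by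
  obtain ⟨rfl, rfl⟩ := hπ
  rw [integral_map measurable_fst.aemeasurable hf.1, integral_map measurable_snd.aemeasurable hg.1,
    ← integral_const_mul, ← integral_add]
  · refine integral_mono_ae (hf.comp_measurable measurable_fst) ?_ h
    exact (hg.comp_measurable measurable_snd).add (hI.const_mul c)
  · exact hg.comp_measurable measurable_snd
  · exact hI.const_mul c

lemma integrable_or_cost_eq_top (π : Measure (E d × E d)) :
    ∫⁻ p, ENNReal.ofReal (‖p.1 - p.2‖ ^ 2) ∂π = ⊤ ∨
      Integrable (fun p : E d × E d => ‖p.1 - p.2‖ ^ 2) π := by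
  by_cases h : ∫⁻ p, ENNReal.ofReal (‖p.1 - p.2‖ ^ 2) ∂π = ⊤
  · exact Or.inl h
  · refine Or.inr ⟨by fun_prop, ?_⟩
    rw [hasFiniteIntegral_iff_ofReal (Filter.Eventually.of_forall fun x => by positivity)]
    exact lt_top_iff_ne_top.2 h

lemma coe_integral_eq_lintegral {α : Type*} [MeasurableSpace α] {π : Measure α} {f : α → ℝ}
    (hI : Integrable f π) (h0 : ∀ x, 0 ≤ f x) :
    ((∫⁻ p, ENNReal.ofReal (f p) ∂π : ℝ≥0∞) : EReal) = ((∫ p, f p ∂π : ℝ) : EReal) := by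
  rw [← ofReal_integral_eq_lintegral_ofReal hI (Filter.Eventually.of_forall h0),
    EReal.coe_ennreal_ofReal, max_eq_left (integral_nonneg h0)]

/-- This is `|u + v|² ≤ (1 + ε)|u|² + (1 + 1/ε)|v|²` with `u = x - y` and `v = y - w`, followed by
the infimum over `w`. -/
lemma Q2_le_moreau_add {φ : E d → EReal} {ε : ℝ} (hε : 0 < ε) (x y : E d) :
    Q2 φ x ≤ moreau (1 + 1 / ε) φ y + (((1 + ε) * ‖x - y‖ ^ 2 : ℝ) : EReal) := by
  rw [← EReal.sub_le_iff_le_add (Or.inl (EReal.coe_ne_bot _)) (Or.inl (EReal.coe_ne_top _))]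
  refine le_iInf fun w => ?_
  rw [EReal.sub_le_iff_le_add (Or.inl (EReal.coe_ne_bot _)) (Or.inl (EReal.coe_ne_top _)),
    add_assoc, ← EReal.coe_add]
  refine (iInf_le _ w).trans (add_le_add_right (EReal.coe_le_coe_iff.2 ?_) _)
  have h := inner_le_mul_sq_add ((2 : ℝ) • (y - w)) (x - y) hε
  have e : x - w = (x - y) + (y - w) := by abel
  rw [norm_smul, inner_smul_left, real_inner_comm (x - y) (y - w), conj_trivial,
    Real.norm_ofNat] at h
  rw [e, norm_add_sq_real]
  have e2 : (2 * ‖y - w‖) ^ 2 / (4 * ε) = 1 / ε * ‖y - w‖ ^ 2 := by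
    field_simp
    ring
  rw [e2] at h
  linarith

/-- The convex order tests only real-valued functions, so it is applied to a Moreau envelope lying
below `φ`; then `ε → 0`. Allowing every `φ` in `L1 ν`, not only in `Sb2`, is what the statement on
optimizers requires. -/
lemma backwardFunctional_le_backwardCost {μ ν : Measure (E d)} (hμ : μ ∈ P2 d) (hν : ν ∈ P2 d)
    {φ : E d → EReal} (hA : φ ∈ Acx d) (hL : φ ∈ L1 ν) :
    backwardFunctional μ ν φ ≤ (backwardCost μ ν : EReal) := by
  rw [EReal_le_coe_iff, backwardCost, le_iInf₂_iff]
  intro η hη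
  rw [← EReal_le_coe_iff, le_transportCost_iff]
  intro π hπ
  rcases integrable_or_cost_eq_top π with h | hI
  · rw [h]; exact le_top
  rw [coe_integral_eq_lintegral hI (fun _ => by positivity)]
  obtain ⟨q, hq, hqc, Cq, hCq⟩ := exists_convexOn_of_mem_Acx_Sb2 (Q2_mem hA)
  have hqI := P2.integrable_of_convexOn hμ hqc hCq
  have hφI := integrable_toReal_of_mem_L1 hL
  rw [backwardFunctional, hq, eIntegral_coe hqI, eIntegral_of_mem_L1 hL, ← EReal.coe_sub,
    EReal.coe_le_coe_iff]
  set c := ∫ p, ‖p.1 - p.2‖ ^ 2 ∂π with hc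
  have hc0 : 0 ≤ c := integral_nonneg fun _ => by positivity
  have key : ∀ ε : ℝ, 0 < ε → ∫ x, q x ∂μ - ∫ x, (φ x).toReal ∂ν ≤ (1 + ε) * c := by
    intro ε hε
    obtain ⟨m, hm, hmc, C, hC⟩ := exists_moreau_eq_coe hA (k := 1 + 1 / ε) (by positivity)
    have hmη := P2.integrable_of_convexOn hη.1 hmc hC
    have hmν := P2.integrable_of_convexOn hν hmc hC
    have h1 := integral_le_of_coupling hπ hqI hmη (c := 1 + ε) hI <|
      Filter.Eventually.of_forall fun p => by
        have := Q2_le_moreau_add (φ := φ) hε p.1 p.2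
        rw [hq, hm] at this
        beta_reduce at this
        exact_mod_cast this
    have h2 := hη.2.integral_le hmc hmη hmν
    have h3 : ∫ x, m x ∂ν ≤ ∫ x, (φ x).toReal ∂ν := by
      refine integral_mono_ae hmν hφI ?_
      filter_upwards [ae_eq_coe_toReal_of_mem_L1 hL] with x hx
      have := moreau_le_self (1 + 1 / ε) φ x
      rw [hm, hx] at this
      exact EReal.coe_le_coe_iff.1 this
    linarith
  refine le_of_forall_pos_le_add fun ε hε => ?_
  have := key (ε / (c + 1)) (by positivity)
  have h2 : ε / (c + 1) * c ≤ ε := by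
    rw [div_mul_eq_mul_div, div_le_iff₀ (by positivity)]
    nlinarith
  linarith

/-- Either `Q_{2̄}(φ)` is an admissible integrable function, or the dual functional is `-∞`. -/
lemma Q2bar_mem_or_forwardFunctional_eq_bot {μ ν : Measure (E d)} (hμ : μ ∈ P2 d) (hν : ν ∈ P2 d)
    {φ : E d → EReal} (h : φ ∈ Acx d ∩ Sb2 d) :
    (Q2bar φ ∈ Acx d ∧ Q2bar φ ∈ L1 ν) ∨ forwardFunctional μ ν φ = ⊥ := by
  have hφν := mem_L1_of_mem_Acx_Sb2 hν h
  have hφμ := mem_L1_of_mem_Acx_Sb2 hμ h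
  by_cases hint : eIntegral ν (Q2bar φ) = ⊤
  · right
    rw [forwardFunctional, hint, EReal.sub_top]
  left
  -- The minorant `φ ≤ Q2bar φ` is `ν`-integrable.
  have hbot : eIntegral ν (Q2bar φ) ≠ ⊥ := by
    refine ne_bot_of_le_ne_bot ?_ (eIntegral_mono (le_Q2bar φ))
    rw [eIntegral_of_mem_L1 hφν]
    exact EReal.coe_ne_bot _
  have hm : AEMeasurable (Q2bar φ) ν := by
    obtain ⟨f, rfl, -⟩ := exists_convexOn_of_mem_Acx_Sb2 h
    exact (lowerSemicontinuous_Q2bar f).measurable.aemeasurable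
  have hL := mem_L1_of_eIntegral hm hint hbot
  refine ⟨Q2bar_mem_Acx h ?_, hL⟩
  have := hν.1
  obtain ⟨y, hy⟩ := (ae_eq_coe_toReal_of_mem_L1 hL).exists
  exact ⟨y, by rw [hy]; exact EReal.coe_ne_top _⟩

lemma forwardFunctional_le_backwardFunctional {μ ν : Measure (E d)} (φ : E d → EReal) :
    forwardFunctional μ ν φ ≤ backwardFunctional μ ν (Q2bar φ) :=
  EReal.sub_le_sub (eIntegral_mono (le_Q2_Q2bar φ)) le_rfl

lemma backwardFunctional_le_forwardFunctional {μ ν : Measure (E d)} (φ : E d → EReal) :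
    backwardFunctional μ ν φ ≤ forwardFunctional μ ν (Q2 φ) :=
  EReal.sub_le_sub le_rfl (eIntegral_mono (Q2bar_Q2_le φ))

lemma forwardFunctional_le_backwardCost {μ ν : Measure (E d)} (hμ : μ ∈ P2 d) (hν : ν ∈ P2 d)
    {φ : E d → EReal} (h : φ ∈ Acx d ∩ Sb2 d) :
    forwardFunctional μ ν φ ≤ (backwardCost μ ν : EReal) := by
  rcases Q2bar_mem_or_forwardFunctional_eq_bot hμ hν h with ⟨hA, hL⟩ | hb
  · exact (forwardFunctional_le_backwardFunctional φ).trans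
      (backwardFunctional_le_backwardCost hμ hν hA hL)
  · rw [hb]; exact bot_le

lemma forwardFunctional_le_forwardCost {μ ν : Measure (E d)} (hμ : μ ∈ P2 d) (hν : ν ∈ P2 d)
    {φ : E d → EReal} (h : φ ∈ Acx d ∩ Sb2 d) :
    forwardFunctional μ ν φ ≤ (forwardCost μ ν : EReal) := by
  rcases Q2bar_mem_or_forwardFunctional_eq_bot hμ hν h with ⟨-, hL⟩ | hb
  swap
  · rw [hb]; exact bot_le
  rw [EReal_le_coe_iff, forwardCost, le_iInf₂_iff]
  intro ξ hξ
  rw [← EReal_le_coe_iff, le_transportCost_iff]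
  intro π hπ
  rcases integrable_or_cost_eq_top π with h' | hI
  · rw [h']; exact le_top
  obtain ⟨f, rfl, hf, C, hC⟩ := exists_convexOn_of_mem_Acx_Sb2 h
  have hfμ := P2.integrable_of_convexOn hμ hf hC
  have hfξ := P2.integrable_of_convexOn hξ.1 hf hC
  have hgI := integrable_toReal_of_mem_L1 hL
  have hae := ae_eq_coe_toReal_of_mem_L1 hL
  rw [coe_integral_eq_lintegral hI (fun _ => by positivity), forwardFunctional, eIntegral_coe hfμ,
    eIntegral_of_mem_L1 hL, ← EReal.coe_sub, EReal.coe_le_coe_iff]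
  have h1 := hξ.2.integral_le hf hfμ hfξ
  -- The real inequality holds only almost everywhere, since `Q2bar` may be infinite on a `ν`-null
  -- set.
  have h2 := integral_le_of_coupling hπ hfξ hgI (c := 1) hI <| by
    rw [← hπ.2] at hae
    filter_upwards [ae_of_ae_map measurable_snd.aemeasurable hae] with p hp
    have := le_iSup (fun x : E d => ((f x : EReal) - ((‖x - p.2‖ ^ 2 : ℝ) : EReal))) p.1
    rw [EReal.sub_le_iff_le_add (Or.inl (EReal.coe_ne_bot _)) (Or.inl (EReal.coe_ne_top _))] at this
    change _ ≤ Q2bar (fun x => (f x : EReal)) p.2 + _ at this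
    rw [hp, ← EReal.coe_add, EReal.coe_le_coe_iff] at this
    rw [one_mul]
    exact this
  linarith

/-! ### A finite-dimensional barycentric transport problem -/

lemma isCompact_rowStochastic {ι κ : Type*} [Fintype κ] :
    IsCompact {q : ι → κ → ℝ | ∀ i, q i ∈ stdSimplex ℝ κ} := by
  have := isCompact_univ_pi fun _ : ι => isCompact_stdSimplex ℝ κ
  simpa [Set.pi] using this

section Finite

variable {ι κ V : Type*} [Fintype ι] [Fintype κ] [NormedAddCommGroup V] [InnerProductSpace ℝ V]

/-- The barycentric cost `∑ᵢ mᵢ |sᵢ - ∑ⱼ qᵢⱼ tⱼ|²`. -/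
def baryCost (m : ι → ℝ) (s : ι → V) (t : κ → V) (q : ι → κ → ℝ) : ℝ :=
  ∑ i, m i * ‖s i - ∑ j, q i j • t j‖ ^ 2

lemma nonneg_of_quadratic_nonneg {L A : ℝ}
    (h : ∀ τ : ℝ, 0 < τ → τ ≤ 1 → 0 ≤ τ * L + τ ^ 2 * A) : 0 ≤ L := by
  by_contra! hL
  have hL0 : 0 < |L| := abs_pos.2 hL.ne
  have hA : 0 < |A| + |L| := by positivity
  -- This `τ` satisfies `τ|A| = |L| - τ|L| < |L|`, so the linear term dominates.
  have h1 := h (|L| / (|A| + |L|)) (by positivity)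
    ((div_le_one hA).2 (by linarith [abs_nonneg A]))
  set τ := |L| / (|A| + |L|) with hτ
  have hτ0 : 0 < τ := by positivity
  have h2 : 0 ≤ L + τ * A := by
    by_contra! h3
    nlinarith
  have h3 : τ * (|A| + |L|) = |L| := by rw [hτ]; field_simp
  have h4 : 0 < τ * |L| := by positivity
  rw [abs_of_neg hL] at h3 h4
  nlinarith [le_abs_self A, mul_le_mul_of_nonneg_left (le_abs_self A) hτ0.le]

/-- The coefficient of `τ` is the directional derivative used in the first-order condition. -/
lemma penalized_expand (m : ι → ℝ) (n : κ → ℝ) (s : ι → V) (t : κ → V) (N : ℝ)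
    (q v : ι → κ → ℝ) (τ : ℝ) :
    baryCost m s t (q + τ • v) + N * ∑ j, (∑ i, m i * (q + τ • v) i j - n j) ^ 2 =
      (baryCost m s t q + N * ∑ j, (∑ i, m i * q i j - n j) ^ 2) +
      (τ * (-2 * ∑ i, m i * inner ℝ (s i - ∑ j, q i j • t j) (∑ j, v i j • t j) +
        2 * N * ∑ j, (∑ i, m i * q i j - n j) * ∑ i, m i * v i j) +
      τ ^ 2 * (∑ i, m i * ‖∑ j, v i j • t j‖ ^ 2 + N * ∑ j, (∑ i, m i * v i j) ^ 2)) := by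
  have h1 : ∀ i, ‖s i - ∑ j, (q + τ • v) i j • t j‖ ^ 2 = ‖s i - ∑ j, q i j • t j‖ ^ 2 -
      2 * (τ * inner ℝ (s i - ∑ j, q i j • t j) (∑ j, v i j • t j)) +
      τ ^ 2 * ‖∑ j, v i j • t j‖ ^ 2 := fun i => by
    have : s i - ∑ j, (q + τ • v) i j • t j =
        (s i - ∑ j, q i j • t j) - τ • ∑ j, v i j • t j := by
      simp only [Pi.add_apply, Pi.smul_apply, smul_eq_mul, add_smul, Finset.sum_add_distrib,
        mul_smul, ← Finset.smul_sum]
      abel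
    rw [this, norm_sub_sq_real, inner_smul_right, norm_smul, mul_pow, Real.norm_eq_abs, sq_abs]
  have h2 : ∀ j, ∑ i, m i * (q + τ • v) i j = ∑ i, m i * q i j + τ * ∑ i, m i * v i j := fun j => by
    simp only [Pi.add_apply, Pi.smul_apply, smul_eq_mul, mul_add, Finset.sum_add_distrib,
      Finset.mul_sum]
    congr 1
    exact Finset.sum_congr rfl fun i _ => by ring
  simp only [baryCost, h1, h2]
  have h3 : ∀ j, (∑ i, m i * q i j + τ * ∑ i, m i * v i j - n j) ^ 2 =
      (∑ i, m i * q i j - n j) ^ 2 + (τ * (2 * ((∑ i, m i * q i j - n j) * ∑ i, m i * v i j)) +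
      τ ^ 2 * (∑ i, m i * v i j) ^ 2) := fun j => by ring
  simp only [h3, Finset.sum_add_distrib, Finset.sum_sub_distrib, mul_add, mul_sub, ← Finset.mul_sum]
  have h4 : ∑ i, m i * (2 * (τ * inner ℝ (s i - ∑ j, q i j • t j) (∑ j, v i j • t j))) =
      2 * τ * ∑ i, m i * inner ℝ (s i - ∑ j, q i j • t j) (∑ j, v i j • t j) := by
    rw [Finset.mul_sum]
    exact Finset.sum_congr rfl fun i _ => by ring
  have h5 : ∑ i, m i * (τ ^ 2 * ‖∑ j, v i j • t j‖ ^ 2) =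
      τ ^ 2 * ∑ i, m i * ‖∑ j, v i j • t j‖ ^ 2 := by
    rw [Finset.mul_sum]
    exact Finset.sum_congr rfl fun i _ => by ring
  rw [h4, h5]
  ring

variable {m : ι → ℝ} {n : κ → ℝ} (s : ι → V) (t : κ → V)

/-- Minimizers of the penalized problem satisfy a dual inequality with explicit multipliers. -/
lemma multiplier_le_of_isMinOn (hm : ∀ i, 0 < m i) {N : ℝ} {q : ι → κ → ℝ}
    (hq : ∀ i, q i ∈ stdSimplex ℝ κ)
    (hmin : ∀ q' : ι → κ → ℝ, (∀ i, q' i ∈ stdSimplex ℝ κ) →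
      baryCost m s t q + N * ∑ j, (∑ i, m i * q i j - n j) ^ 2 ≤
        baryCost m s t q' + N * ∑ j, (∑ i, m i * q' i j - n j) ^ 2) (i : ι) (j : κ) :
    ∑ l, q i l * (2 * N * (∑ i, m i * q i l - n l)) +
      2 * inner ℝ (s i - ∑ l, q i l • t l) (t j - ∑ l, q i l • t l) ≤
      2 * N * (∑ i, m i * q i j - n j) := by
  classical
  set r : κ → ℝ := fun l => ∑ i, m i * q i l - n l with hr
  -- Only row `i` moves, towards the vertex `j` of the simplex.
  let v : ι → κ → ℝ := fun i' => if i' = i then Pi.single j 1 - q i else 0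
  have hL := nonneg_of_quadratic_nonneg fun τ h0 h1 => by
    have hq' : ∀ i', (q + τ • v) i' ∈ stdSimplex ℝ κ := by
      intro i'
      by_cases h : i' = i
      · subst h
        have : (q + τ • v) i' = (1 - τ) • q i' + τ • Pi.single j 1 := by
          simp only [v, Pi.add_apply, Pi.smul_apply, if_true]
          module
        rw [this]
        exact convex_stdSimplex ℝ κ (hq i') (single_mem_stdSimplex ℝ j) (by linarith) h0.le
          (by ring)
      · have : (q + τ • v) i' = q i' := by simp [v, h]
        rw [this]
        exact hq i'
    have h := hmin (q + τ • v) hq'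
    rw [penalized_expand] at h
    exact le_add_iff_nonneg_right _ |>.1 h
  have e1 : ∑ i', m i' * inner ℝ (s i' - ∑ l, q i' l • t l) (∑ l, v i' l • t l) =
      m i * inner ℝ (s i - ∑ l, q i l • t l) (t j - ∑ l, q i l • t l) := by
    rw [Finset.sum_eq_single i]
    · simp [v, sub_smul, Finset.sum_sub_distrib, Pi.single_apply]
    · intro i' _ h
      simp [v, h]
    · simp
  have e2 : ∀ l, ∑ i', m i' * v i' l = m i * ((Pi.single j 1 : κ → ℝ) l - q i l) := fun l => by
    rw [Finset.sum_eq_single i]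
    · simp [v]
    · intro i' _ h
      simp [v, h]
    · simp
  have e3 : ∑ l, r l * (m i * ((Pi.single j 1 : κ → ℝ) l - q i l)) =
      m i * (r j - ∑ l, q i l * r l) := by
    simp only [mul_sub, Finset.sum_sub_distrib, Pi.single_apply, mul_ite, mul_one, mul_zero,
      Finset.sum_ite_eq', Finset.mem_univ, if_true, Finset.mul_sum]
    rw [mul_comm]
    congr 1
    exact Finset.sum_congr rfl fun l _ => by ring
  simp only [e1, e2] at hL
  rw [e3] at hL
  have e4 : ∑ l, q i l * (2 * N * r l) = 2 * N * ∑ l, q i l * r l := by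
    rw [Finset.mul_sum]
    exact Finset.sum_congr rfl fun l _ => by ring
  change ∑ l, q i l * (2 * N * r l) + _ ≤ 2 * N * r j
  rw [e4]
  have : 0 ≤ m i * (2 * N * (r j - ∑ l, q i l * r l) -
      2 * inner ℝ (s i - ∑ l, q i l • t l) (t j - ∑ l, q i l • t l)) := by linarith
  have := nonneg_of_mul_nonneg_right this (hm i)
  linarith

/-- There is an exact coupling whose barycentric cost is approached by plans that admit dual
multipliers. -/
theorem exists_coupling_multipliers (hm : ∀ i, 0 < m i) (hm1 : ∑ i, m i = 1)
    (hn : n ∈ stdSimplex ℝ κ) :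
    ∃ q₀ : ι → κ → ℝ, (∀ i, q₀ i ∈ stdSimplex ℝ κ) ∧ (∀ j, ∑ i, m i * q₀ i j = n j) ∧
      ∀ ε : ℝ, 0 < ε → ∃ (q : ι → κ → ℝ) (ψ : κ → ℝ), (∀ i, q i ∈ stdSimplex ℝ κ) ∧
        baryCost m s t q₀ - ε ≤ baryCost m s t q ∧
        0 ≤ ∑ j, ψ j * (∑ i, m i * q i j - n j) ∧
        ∀ i j, ∑ l, q i l * ψ l +
          2 * inner ℝ (s i - ∑ l, q i l • t l) (t j - ∑ l, q i l • t l) ≤ ψ j := by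
  set S := {q : ι → κ → ℝ | ∀ i, q i ∈ stdSimplex ℝ κ} with hS
  have hcF : Continuous (baryCost m s t) := by unfold baryCost; fun_prop
  have hcR : Continuous fun q : ι → κ → ℝ => ∑ j, (∑ i, m i * q i j - n j) ^ 2 := by fun_prop
  have hfeas : (fun (_ : ι) => n) ∈ S := fun _ => hn
  have hfeas0 : ∑ j, (∑ i, m i * n j - n j) ^ 2 = 0 := by
    simp [← Finset.sum_mul, hm1]
  have hmin : ∀ N : ℕ, ∃ q ∈ S, ∀ q' ∈ S,
      baryCost m s t q + (N : ℝ) * ∑ j, (∑ i, m i * q i j - n j) ^ 2 ≤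
        baryCost m s t q' + (N : ℝ) * ∑ j, (∑ i, m i * q' i j - n j) ^ 2 := fun N =>
    isCompact_rowStochastic.exists_isMinOn ⟨_, hfeas⟩
      (hcF.add (continuous_const.mul hcR)).continuousOn
  choose q hqS hq using hmin
  obtain ⟨q₀, hq₀, φ, hφ, hlim⟩ := isCompact_rowStochastic.tendsto_subseq hqS
  -- Comparison with the independent coupling, whose residual vanishes. Dividing by `N` makes the
  -- limit `q₀` feasible.
  have hbound : ∀ N : ℕ, (N : ℝ) * ∑ j, (∑ i, m i * q N i j - n j) ^ 2 ≤
      baryCost m s t fun _ => n := fun N => by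
    have h1 := hq N _ hfeas
    rw [hfeas0, mul_zero, add_zero] at h1
    have h2 : 0 ≤ baryCost m s t (q N) :=
      Finset.sum_nonneg fun i _ => mul_nonneg (hm i).le (sq_nonneg _)
    linarith
  have hzero : ∑ j, (∑ i, m i * q₀ i j - n j) ^ 2 = 0 := by
    refine le_antisymm ?_ (Finset.sum_nonneg fun j _ => sq_nonneg _)
    have h1 : Filter.Tendsto (fun k => (baryCost m s t fun _ => n) / (φ k : ℝ)) Filter.atTop
        (nhds 0) :=
      (tendsto_const_div_atTop_nhds_zero_nat _).comp hφ.tendsto_atTop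
    refine le_of_tendsto_of_tendsto ((hcR.tendsto q₀).comp hlim) h1 ?_
    filter_upwards [Filter.eventually_gt_atTop 0] with k hk
    have hpos : (0 : ℝ) < φ k := by
      exact_mod_cast hk.trans_le (hφ.id_le k)
    rw [le_div_iff₀ hpos, mul_comm]
    exact hbound (φ k)
  refine ⟨q₀, hq₀, fun j => ?_, fun ε hε => ?_⟩
  · have := (Finset.sum_eq_zero_iff_of_nonneg fun j _ => sq_nonneg _).1 hzero j (Finset.mem_univ j)
    exact sub_eq_zero.1 (pow_eq_zero_iff two_ne_zero |>.1 this)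
  -- Only the cost passes to the limit. The multipliers `2N · residual` need not stay bounded, so
  -- they are kept at a finite `N`.
  · have h1 := ((hcF.tendsto q₀).comp hlim).eventually_const_lt (sub_lt_self _ hε)
    obtain ⟨k, hk⟩ := h1.exists
    refine ⟨q (φ k), fun l => 2 * (φ k : ℝ) * (∑ i, m i * q (φ k) i l - n l), hqS _, hk.le, ?_,
      multiplier_le_of_isMinOn s t hm (hqS _) (hq _)⟩
    exact Finset.sum_nonneg fun j _ => by
      rw [mul_assoc, ← sq]
      positivity

end Finite

/-! ### Finite mixtures of measures -/

/-- The mixture `∑ᵢ wᵢ μᵢ`. -/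
noncomputable def mix {α ι : Type*} [MeasurableSpace α] [Fintype ι] (w : ι → ℝ)
    (μs : ι → Measure α) : Measure α :=
  ∑ i, ENNReal.ofReal (w i) • μs i

section Mix

variable {α β ι κ : Type*} [MeasurableSpace α] [MeasurableSpace β] [Fintype ι] [Fintype κ]
  {w : ι → ℝ} {μs : ι → Measure α}

lemma lintegral_mix (w : ι → ℝ) (μs : ι → Measure α) (f : α → ℝ≥0∞) :
    ∫⁻ x, f x ∂mix w μs = ∑ i, ENNReal.ofReal (w i) * ∫⁻ x, f x ∂μs i := by
  simp [mix, lintegral_finsetSum_measure, lintegral_smul_measure]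

lemma integrable_mix {F : Type*} [NormedAddCommGroup F] {f : α → F}
    (h : ∀ i, Integrable f (μs i)) : Integrable f (mix w μs) :=
  integrable_finsetSum_measure.2 fun i _ => (h i).smul_measure ENNReal.ofReal_ne_top

lemma integrable_of_integrable_mix {F : Type*} [NormedAddCommGroup F] {f : α → F}
    (hw : ∀ i, 0 < w i) (h : Integrable f (mix w μs)) (i : ι) : Integrable f (μs i) :=
  (integrable_smul_measure (ENNReal.ofReal_pos.2 (hw i)).ne' ENNReal.ofReal_ne_top).1
    (integrable_finsetSum_measure.1 h i (Finset.mem_univ i))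

lemma integral_mix {F : Type*} [NormedAddCommGroup F] [NormedSpace ℝ F] {f : α → F}
    (hw : ∀ i, 0 ≤ w i) (h : ∀ i, Integrable f (μs i)) :
    ∫ x, f x ∂mix w μs = ∑ i, w i • ∫ x, f x ∂μs i := by
  rw [mix, integral_finsetSum_measure fun i _ => (h i).smul_measure ENNReal.ofReal_ne_top]
  refine Finset.sum_congr rfl fun i _ => ?_
  rw [integral_smul_measure, ENNReal.toReal_ofReal (hw i)]

lemma map_mix {f : α → β} (hf : Measurable f) :
    (mix w μs).map f = mix w fun i => (μs i).map f := by
  simp only [mix, Measure.map_finset_sum' hf.aemeasurable, Measure.map_smul]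

lemma isProbabilityMeasure_mix (hw : ∀ i, 0 ≤ w i) (hw1 : ∑ i, w i = 1)
    (h : ∀ i, IsProbabilityMeasure (μs i)) : IsProbabilityMeasure (mix w μs) := by
  constructor
  rw [← lintegral_one, lintegral_mix]
  simp only [lintegral_one, measure_univ, mul_one]
  rw [← ENNReal.ofReal_sum_of_nonneg fun i _ => hw i, hw1, ENNReal.ofReal_one]

lemma mix_mix {q : ι → κ → ℝ} (hw : ∀ i, 0 ≤ w i) (hq : ∀ i j, 0 ≤ q i j)
    (νs : κ → Measure α) :
    mix w (fun i => mix (q i) νs) = mix (fun j => ∑ i, w i * q i j) νs := by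
  simp only [mix, Finset.smul_sum, smul_smul]
  rw [Finset.sum_comm]
  refine Finset.sum_congr rfl fun j _ => ?_
  rw [← Finset.sum_smul, ENNReal.ofReal_sum_of_nonneg fun i _ => mul_nonneg (hw i) (hq i j)]
  congr 1
  exact Finset.sum_congr rfl fun i _ => (ENNReal.ofReal_mul (hw i)).symm

end Mix

/-- `μ` is the mixture, with positive weights `w`, of the probability measures `μs`. -/
structure IsMixture {ι : Type*} [Fintype ι] (μ : Measure (E d)) (w : ι → ℝ)
    (μs : ι → Measure (E d)) : Prop where
  pos : ∀ i, 0 < w i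
  sum_eq_one : ∑ i, w i = 1
  prob : ∀ i, IsProbabilityMeasure (μs i)
  eq_mix : μ = mix w μs

lemma P2.integrable_id {μ : Measure (E d)} (hμ : μ ∈ P2 d) : Integrable (fun x : E d => x) μ := by
  have := hμ.1
  refine ((integrable_const (1 : ℝ)).add (P2.integrable_sq_norm hμ)).mono' (by fun_prop)
    (Filter.Eventually.of_forall fun x => ?_)
  simp only [Pi.add_apply]
  nlinarith [sq_nonneg (‖x‖ - 1)]

lemma mem_P2_of_integrable {μ : Measure (E d)} [IsProbabilityMeasure μ]
    (h : Integrable (fun x => ‖x‖ ^ 2) μ) : μ ∈ P2 d :=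
  ⟨inferInstance, h.lintegral_lt_top⟩

lemma IsMixture.mem_P2 {ι : Type*} [Fintype ι] {μ : Measure (E d)} {w : ι → ℝ}
    {μs : ι → Measure (E d)} (h : IsMixture μ w μs) (hμ : μ ∈ P2 d) (i : ι) : μs i ∈ P2 d := by
  have := h.prob i
  have h2 := (P2.integrable_sq_norm hμ)
  rw [h.eq_mix] at h2
  exact mem_P2_of_integrable (integrable_of_integrable_mix h.pos h2 i)

lemma mix_mem_P2 {ι : Type*} [Fintype ι] {w : ι → ℝ} {μs : ι → Measure (E d)}
    (hw : ∀ i, 0 ≤ w i) (hw1 : ∑ i, w i = 1) (h : ∀ i, μs i ∈ P2 d) : mix w μs ∈ P2 d := by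
  have := isProbabilityMeasure_mix hw hw1 fun i => (h i).1
  exact mem_P2_of_integrable (integrable_mix fun i => (P2.integrable_sq_norm (h i)))

/-! ### Convex order and Jensen's inequality -/

lemma exists_affine_le_of_convexOn {φ : E d → ℝ} (hφ : ConvexOn ℝ Set.univ φ) :
    ∃ (a : E d) (c : ℝ), ∀ x, inner ℝ a x + c ≤ φ x := by
  obtain ⟨a, c, h⟩ := exists_affine_le_of_mem_Acx (coe_mem_Acx hφ)
  exact ⟨a, c, fun x => EReal.coe_le_coe_iff.1 (h x)⟩

lemma integrable_of_convexOn_le {μ : Measure (E d)} [IsProbabilityMeasure μ]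
    (hμ : Integrable (fun x : E d => x) μ) {φ g : E d → ℝ} (hφ : ConvexOn ℝ Set.univ φ)
    (hg : Integrable g μ) (h : ∀ᵐ x ∂μ, φ x ≤ g x) : Integrable φ μ := by
  obtain ⟨a, c, hac⟩ := exists_affine_le_of_convexOn hφ
  have hl : Integrable (fun x => inner ℝ a x + c) μ := (hμ.const_inner a).add (integrable_const c)
  refine (hl.abs.add hg.abs).mono' (continuous_of_convexOn hφ).aestronglyMeasurable ?_
  filter_upwards [h] with x hx
  rw [Real.norm_eq_abs, Pi.add_apply, abs_le]
  constructor
  · linarith [hac x, neg_abs_le (inner ℝ a x + c), abs_nonneg (g x)]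
  · linarith [le_abs_self (g x), abs_nonneg (inner ℝ a x + c)]

/-- An affine minorant makes the negative part of `φ` integrable for `ξ`; hence either `∫ φ dξ =
+∞`, a trivial case, or `φ` is integrable. -/
lemma convexOrder_of_integral_le {μ ξ : Measure (E d)} [IsProbabilityMeasure ξ]
    (hξ : Integrable (fun x : E d => x) ξ)
    (h : ∀ φ : E d → ℝ, ConvexOn ℝ Set.univ φ → Integrable φ ξ →
      Integrable φ μ ∧ ∫ x, φ x ∂μ ≤ ∫ x, φ x ∂ξ) : ConvexOrder μ ξ := by
  intro φ hφ _ _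
  have hcont := continuous_of_convexOn hφ
  obtain ⟨a, c, hac⟩ := exists_affine_le_of_convexOn hφ
  have hl : Integrable (fun x => inner ℝ a x + c) ξ := (hξ.const_inner a).add (integrable_const c)
  have hneg : ∫⁻ x, ENNReal.ofReal (-φ x) ∂ξ < ∞ := by
    refine lt_of_le_of_lt (lintegral_mono fun x => ENNReal.ofReal_le_ofReal ?_)
      hl.neg.lintegral_lt_top
    exact neg_le_neg (hac x)
  by_cases htop : ∫⁻ x, ENNReal.ofReal (φ x) ∂ξ = ∞
  · have : eIntegral ξ (fun x => (φ x : EReal)) = ⊤ := by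
      change ((∫⁻ x, ENNReal.ofReal (φ x) ∂ξ : ℝ≥0∞) : EReal) -
        ((∫⁻ x, ENNReal.ofReal (-φ x) ∂ξ : ℝ≥0∞) : EReal) = ⊤
      rw [htop, EReal.coe_ennreal_top, EReal.top_sub]
      exact fun h => hneg.ne (EReal.coe_ennreal_eq_top_iff.1 h)
    rw [this]
    exact le_top
  · have hI : Integrable φ ξ := integrable_toReal_of_mem_L1
      (φ := fun x => (φ x : EReal)) ⟨hcont.measurable.coe_real_ereal.aemeasurable,
        lt_top_iff_ne_top.2 htop, hneg⟩
    obtain ⟨h1, h2⟩ := h φ hφ hI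
    rw [eIntegral_coe h1, eIntegral_coe hI]
    exact EReal.coe_le_coe_iff.2 h2

lemma convexOn_integral_id_le {κ : Measure (E d)} [IsProbabilityMeasure κ]
    (hκ : Integrable (fun x : E d => x) κ) {φ : E d → ℝ} (hφ : ConvexOn ℝ Set.univ φ)
    (hI : Integrable φ κ) : φ (∫ z, z ∂κ) ≤ ∫ z, φ z ∂κ :=
  hφ.map_integral_le (continuous_of_convexOn hφ).continuousOn isClosed_univ
    (Filter.Eventually.of_forall fun _ => Set.mem_univ _) hκ hI

/-- Convolving with a centred measure increases integrals of convex functions. -/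
lemma integral_le_integral_add_centred {μ κ : Measure (E d)} [IsProbabilityMeasure μ]
    [IsProbabilityMeasure κ] (hμ : Integrable (fun x : E d => x) μ)
    (hκ : Integrable (fun x : E d => x) κ) {φ : E d → ℝ} (hφ : ConvexOn ℝ Set.univ φ)
    (hI : Integrable (fun p : E d × E d => φ (p.1 + p.2 - ∫ z, z ∂κ)) (μ.prod κ)) :
    Integrable φ μ ∧ ∫ x, φ x ∂μ ≤ ∫ p, φ (p.1 + p.2 - ∫ z, z ∂κ) ∂μ.prod κ := by
  set b := ∫ z, z ∂κ with hb
  have hG := hI.integral_prod_left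
  -- Jensen in `z`: for fixed `x` the variable `x + z - b` has mean `x`.
  have hle : ∀ᵐ x ∂μ, φ x ≤ ∫ z, φ (x + z - b) ∂κ := by
    filter_upwards [hI.prod_right_ae] with x hx
    have hmean : ∫ z, (x + z - b) ∂κ = x := by
      have h1 : Integrable (fun z : E d => x + z) κ := (integrable_const x).add hκ
      rw [integral_sub h1 (integrable_const b), integral_add (integrable_const x) hκ]
      simp [← hb]
    have := hφ.map_integral_le (μ := κ) (f := fun z => x + z - b)
      (continuous_of_convexOn hφ).continuousOn isClosed_univ
      (Filter.Eventually.of_forall fun _ => Set.mem_univ _)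
      (((integrable_const x).add hκ).sub (integrable_const b)) hx
    rwa [hmean] at this
  have hφI := integrable_of_convexOn_le hμ hφ hG hle
  refine ⟨hφI, ?_⟩
  rw [integral_prod _ hI]
  exact integral_mono_ae hφI hG hle

/-! ### Barycentric couplings bound both projection costs -/

lemma integral_id_mix {ι κ : Type*} [Fintype κ] {ν : Measure (E d)} {n : κ → ℝ}
    {νs : κ → Measure (E d)} {q : ι → κ → ℝ} (hν : IsMixture ν n νs) (hνP : ν ∈ P2 d)
    (hq : ∀ i, q i ∈ stdSimplex ℝ κ) (i : ι) :
    ∫ z, z ∂mix (q i) νs = ∑ j, q i j • ∫ z, z ∂νs j :=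
  integral_mix (hq i).1 fun j => P2.integrable_id (hν.mem_P2 hνP j)

section Costs

variable {ι κ : Type*} [Fintype ι] [Fintype κ] {μ ν : Measure (E d)} {m : ι → ℝ} {n : κ → ℝ}
  {μs : ι → Measure (E d)} {νs : κ → Measure (E d)} {q : ι → κ → ℝ}

lemma mix_mix_eq (hν : IsMixture ν n νs) (hm : ∀ i, 0 < m i)
    (hq : ∀ i, q i ∈ stdSimplex ℝ κ) (hqn : ∀ j, ∑ i, m i * q i j = n j) :
    mix m (fun i => mix (q i) νs) = ν := by
  rw [mix_mix (fun i => (hm i).le) (fun i => (hq i).1), hν.eq_mix]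
  congr 1
  exact funext hqn

lemma transportCost_le {α β : Measure (E d)} {π : Measure (E d × E d)} (h : π ∈ couplings α β) :
    transportCost α β ≤ ∫⁻ p, ENNReal.ofReal (‖p.1 - p.2‖ ^ 2) ∂π := iInf₂_le π h

/-- The competitor collapses each piece `mix (q i) νs` of `ν` to its barycentre, and all of `μs i`
is sent there. -/
lemma backwardCost_le (hμ : IsMixture μ m μs) (hν : IsMixture ν n νs) (hνP : ν ∈ P2 d)
    (hq : ∀ i, q i ∈ stdSimplex ℝ κ) (hqn : ∀ j, ∑ i, m i * q i j = n j) :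
    backwardCost μ ν ≤ ∑ i, ENNReal.ofReal (m i) *
      ∫⁻ x, ENNReal.ofReal (‖x - ∫ z, z ∂mix (q i) νs‖ ^ 2) ∂μs i := by
  have hm0 : ∀ i, 0 ≤ m i := fun i => (hμ.pos i).le
  have hκP : ∀ i, mix (q i) νs ∈ P2 d := fun i =>
    mix_mem_P2 (hq i).1 (hq i).2 fun j => hν.mem_P2 hνP j
  have hν1 := hνP.1
  have hκ1 : ∀ i, IsProbabilityMeasure (mix (q i) νs) := fun i => (hκP i).1
  have hμ1 := hμ.prob
  set b : ι → E d := fun i => ∫ z, z ∂mix (q i) νs with hb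
  have hηP : mix m (fun i => Measure.dirac (b i)) ∈ P2 d := mix_mem_P2 hm0 hμ.sum_eq_one fun i =>
    mem_P2_of_integrable (integrable_dirac (by simp))
  have hη : mix m (fun i => Measure.dirac (b i)) ∈ backwardCone ν := by
    refine ⟨hηP, convexOrder_of_integral_le (P2.integrable_id hνP) fun φ hφ hI => ?_⟩
    have hIκ : ∀ i, Integrable φ (mix (q i) νs) := fun i => integrable_mix fun j => by
      rw [hν.eq_mix] at hI
      exact integrable_of_integrable_mix hν.pos hI j
    have hd : ∀ i, Integrable φ (Measure.dirac (b i)) := fun i => integrable_dirac (by simp)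
    refine ⟨integrable_mix hd, ?_⟩
    rw [← mix_mix_eq hν hμ.pos hq hqn, integral_mix hm0 hd, integral_mix hm0 hIκ]
    refine Finset.sum_le_sum fun i _ => ?_
    rw [integral_dirac]
    exact mul_le_mul_of_nonneg_left
      (convexOn_integral_id_le (P2.integrable_id (hκP i)) hφ (hIκ i)) (hm0 i)
  refine (iInf₂_le _ hη).trans ((transportCost_le
    (π := mix m fun i => (μs i).prod (Measure.dirac (b i))) ⟨?_, ?_⟩).trans_eq ?_)
  · rw [map_mix measurable_fst, hμ.eq_mix]
    congr 1
    funext i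
    simp
  · rw [map_mix measurable_snd]
    congr 1
    funext i
    simp
  · rw [lintegral_mix]
    refine Finset.sum_congr rfl fun i _ => ?_
    rw [lintegral_prod _ (by fun_prop)]
    congr 1
    refine lintegral_congr fun x => ?_
    rw [lintegral_dirac]

/-- The competitor mixes the laws of `X + Z - b i`, with `X ∼ μs i` and `Z ∼ mix (q i) νs`
independent. Coupling it with `Z` leaves the displacement `X - b i`, hence the backward bound again.
-/
lemma forwardCost_le (hμ : IsMixture μ m μs) (hμP : μ ∈ P2 d) (hν : IsMixture ν n νs)
    (hνP : ν ∈ P2 d)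
    (hq : ∀ i, q i ∈ stdSimplex ℝ κ) (hqn : ∀ j, ∑ i, m i * q i j = n j) :
    forwardCost μ ν ≤ ∑ i, ENNReal.ofReal (m i) *
      ∫⁻ x, ENNReal.ofReal (‖x - ∫ z, z ∂mix (q i) νs‖ ^ 2) ∂μs i := by
  have hm0 : ∀ i, 0 ≤ m i := fun i => (hμ.pos i).le
  have hκP : ∀ i, mix (q i) νs ∈ P2 d := fun i =>
    mix_mem_P2 (hq i).1 (hq i).2 fun j => hν.mem_P2 hνP j
  have hκ1 : ∀ i, IsProbabilityMeasure (mix (q i) νs) := fun i => (hκP i).1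
  have hμ1 := hμ.prob
  set b : ι → E d := fun i => ∫ z, z ∂mix (q i) νs with hb
  let T : ι → E d × E d → E d := fun i p => p.1 + p.2 - b i
  have hT : ∀ i, Measurable (T i) := fun i => by fun_prop
  let ξs : ι → Measure (E d) := fun i => ((μs i).prod (mix (q i) νs)).map (T i)
  have hξsP : ∀ i, ξs i ∈ P2 d := fun i => by
    have : IsProbabilityMeasure (ξs i) := Measure.isProbabilityMeasure_map (hT i).aemeasurable
    refine mem_P2_of_integrable ?_
    rw [integrable_map_measure (by fun_prop) (hT i).aemeasurable]
    have h1 : Integrable (fun p : E d × E d => ‖p.1‖ ^ 2) ((μs i).prod (mix (q i) νs)) :=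
      (P2.integrable_sq_norm (hμ.mem_P2 hμP i)).comp_fst _
    have h2 : Integrable (fun p : E d × E d => ‖p.2‖ ^ 2) ((μs i).prod (mix (q i) νs)) :=
      (P2.integrable_sq_norm (hκP i)).comp_snd _
    refine (((h1.const_mul 4).add (h2.const_mul 4)).add
      (integrable_const (2 * ‖b i‖ ^ 2))).mono' (by fun_prop)
      (Filter.Eventually.of_forall fun p => ?_)
    have h3 := sq_norm_sub_le (p.1 + p.2) (b i)
    have h4 := sq_norm_sub_le p.1 (-p.2)
    rw [sub_neg_eq_add, norm_neg] at h4
    simp only [Function.comp_apply, Pi.add_apply, T, Real.norm_eq_abs, abs_pow, abs_norm]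
    linarith
  have hξP : mix m ξs ∈ P2 d := mix_mem_P2 hm0 hμ.sum_eq_one hξsP
  have hξ1 := hξP.1
  have hξ : mix m ξs ∈ forwardCone μ := by
    refine ⟨hξP, convexOrder_of_integral_le (P2.integrable_id hξP) fun φ hφ hI => ?_⟩
    have hIξ := integrable_of_integrable_mix hμ.pos hI
    have hφm := continuous_of_convexOn hφ
    have key := fun i => integral_le_integral_add_centred (μ := μs i) (κ := mix (q i) νs)
      (P2.integrable_id (hμ.mem_P2 hμP i)) (P2.integrable_id (hκP i)) hφ
      ((integrable_map_measure hφm.aestronglyMeasurable (hT i).aemeasurable).1 (hIξ i))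
    rw [hμ.eq_mix]
    refine ⟨integrable_mix fun i => (key i).1, ?_⟩
    rw [integral_mix hm0 fun i => (key i).1, integral_mix hm0 hIξ]
    refine Finset.sum_le_sum fun i _ => mul_le_mul_of_nonneg_left ?_ (hm0 i)
    rw [integral_map (hT i).aemeasurable hφm.aestronglyMeasurable]
    exact (key i).2
  have hTm : ∀ i, Measurable fun p : E d × E d => (T i p, p.2) := fun i => by fun_prop
  refine (iInf₂_le _ hξ).trans ((transportCost_le (π := mix m fun i =>
    ((μs i).prod (mix (q i) νs)).map fun p => (T i p, p.2)) ⟨?_, ?_⟩).trans_eq ?_)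
  · rw [map_mix measurable_fst]
    congr 1
    funext i
    rw [Measure.map_map measurable_fst (hTm i)]
    rfl
  · rw [map_mix measurable_snd]
    conv_rhs => rw [← mix_mix_eq hν hμ.pos hq hqn]
    congr 1
    funext i
    rw [Measure.map_map measurable_snd (hTm i)]
    change Measure.map Prod.snd _ = _
    simp
  · rw [lintegral_mix]
    refine Finset.sum_congr rfl fun i _ => ?_
    rw [lintegral_map (by fun_prop) (hTm i), lintegral_prod _ (by fun_prop)]
    congr 1
    refine lintegral_congr fun x => ?_
    have : ∀ y : E d, T i (x, y) - y = x - b i := fun y => by simp only [T]; abel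
    simp [this, hb]

end Costs

/-! ### Approximation by mixtures of small variance -/

lemma integrable_sq_norm_sub {P : Measure (E d)} (hP : P ∈ P2 d) (c : E d) :
    Integrable (fun x => ‖x - c‖ ^ 2) P := by
  have := hP.1
  refine (((P2.integrable_sq_norm hP).const_mul 2).add
    (integrable_const (2 * ‖c‖ ^ 2))).mono' (by fun_prop) (Filter.Eventually.of_forall fun x => ?_)
  rw [Real.norm_eq_abs, abs_of_nonneg (by positivity)]
  exact sq_norm_sub_le x c

lemma integral_sub_id {P : Measure (E d)} (hP : P ∈ P2 d) (c : E d) :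
    ∫ x, (x - c) ∂P = ∫ x, x ∂P - c := by
  have := hP.1
  rw [integral_sub (P2.integrable_id hP) (integrable_const c)]
  simp

/-- The bias-variance decomposition. -/
lemma integral_sq_norm_sub {P : Measure (E d)} (hP : P ∈ P2 d) (c : E d) :
    ∫ x, ‖x - c‖ ^ 2 ∂P = ‖∫ x, x ∂P - c‖ ^ 2 + ∫ x, ‖x - ∫ z, z ∂P‖ ^ 2 ∂P := by
  have := hP.1
  set s := ∫ x, x ∂P with hs
  have e : ∀ x, ‖x - c‖ ^ 2 = ‖x - s‖ ^ 2 + (2 * inner ℝ (s - c) (x - s) + ‖s - c‖ ^ 2) := by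
    intro x
    have : x - c = (x - s) + (s - c) := by abel
    rw [this, norm_add_sq_real, real_inner_comm]
    ring
  have hsub : Integrable (fun x => x - s) P := (P2.integrable_id hP).sub (integrable_const s)
  have hinner : Integrable (fun x => 2 * inner ℝ (s - c) (x - s)) P :=
    (hsub.const_inner (s - c)).const_mul 2
  have hadd : Integrable (fun x => 2 * inner ℝ (s - c) (x - s) + ‖s - c‖ ^ 2) P :=
    hinner.add (integrable_const _)
  rw [funext e]
  rw [integral_add (integrable_sq_norm_sub hP s) hadd, integral_add hinner (integrable_const _),
    integral_const_mul, integral_inner hsub, integral_sub_id hP, ← hs, sub_self, inner_zero_right]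
  simp
  ring

lemma exists_simpleFunc_integral_sq_norm_sub_le {ν : Measure (E d)} (hν : ν ∈ P2 d) {δ : ℝ}
    (hδ : 0 < δ) : ∃ f : SimpleFunc (E d) (E d), Integrable (fun x => ‖x - f x‖ ^ 2) ν ∧
      ∫ x, ‖x - f x‖ ^ 2 ∂ν ≤ δ := by
  have hid : MemLp (fun x : E d => x) 2 ν :=
    (memLp_two_iff_integrable_sq_norm (by fun_prop)).2 (P2.integrable_sq_norm hν)
  obtain ⟨f, hf, hfm⟩ := hid.exists_simpleFunc_eLpNorm_sub_lt (by simp)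
    (ε := ENNReal.ofReal (Real.sqrt δ)) (ENNReal.ofReal_pos.2 (Real.sqrt_pos.2 hδ)).ne'
  have hsub : MemLp (fun x : E d => x - f x) 2 ν := hid.sub hfm
  have hI := (memLp_two_iff_integrable_sq_norm hsub.1).1 hsub
  refine ⟨f, hI, ?_⟩
  have h1 : eLpNorm (fun x : E d => x - f x) 2 ν < ENNReal.ofReal (Real.sqrt δ) := hf
  rw [hsub.eLpNorm_eq_integral_rpow_norm (by simp) (by simp),
    ENNReal.ofReal_lt_ofReal_iff (Real.sqrt_pos.2 hδ)] at h1
  simp only [ENNReal.toReal_ofNat, Real.rpow_ofNat] at h1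
  rw [← one_div, ← Real.sqrt_eq_rpow] at h1
  exact ((Real.sqrt_lt_sqrt_iff (integral_nonneg fun _ => by positivity)).1 h1).le

open scoped ProbabilityTheory in
/-- Every measure in `P₂` is a finite mixture of probability measures of small mean variance. -/
theorem exists_isMixture {ν : Measure (E d)} (hν : ν ∈ P2 d) {δ : ℝ} (hδ : 0 < δ) :
    ∃ (κ : Type) (_ : Fintype κ) (n : κ → ℝ) (νs : κ → Measure (E d)), IsMixture ν n νs ∧
      ∑ j, n j * ∫ x, ‖x - ∫ z, z ∂νs j‖ ^ 2 ∂νs j ≤ δ := by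
  classical
  have := hν.1
  obtain ⟨f, hfI, hf⟩ := exists_simpleFunc_integral_sq_norm_sub_le hν hδ
  -- The pieces are `ν` conditioned on the fibres of a simple function close to the identity in
  -- `L²`; null fibres are dropped to keep the weights positive.
  let R := f.range.filter fun y => ν (f ⁻¹' {y}) ≠ 0
  let n : R → ℝ := fun y => (ν (f ⁻¹' {y.1})).toReal
  let νs : R → Measure (E d) := fun y => ν[|f ⁻¹' {y.1}]
  have hne : ∀ y : R, ν (f ⁻¹' {y.1}) ≠ 0 := fun y => (Finset.mem_filter.1 y.2).2
  have hn : ∀ y, ENNReal.ofReal (n y) = ν (f ⁻¹' {y.1}) := fun y =>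
    ENNReal.ofReal_toReal (measure_ne_top _ _)
  have hprob : ∀ y, IsProbabilityMeasure (νs y) := fun y =>
    ProbabilityTheory.cond_isProbabilityMeasure (hne y)
  have heq : ν = mix n νs := by
    ext A hA
    have h1 : mix n νs A = ∑ y : R, ν.restrict A (f ⁻¹' {y.1}) := by
      rw [mix, Measure.finsetSum_apply]
      refine Finset.sum_congr rfl fun y _ => ?_
      rw [Measure.smul_apply, hn, smul_eq_mul, ProbabilityTheory.cond_apply' hA, ← mul_assoc,
        ENNReal.mul_inv_cancel (hne y) (measure_ne_top _ _), one_mul,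
        Measure.restrict_apply (f.measurableSet_fiber _)]
    rw [h1, Finset.sum_coe_sort R fun y => ν.restrict A (f ⁻¹' {y}), Finset.sum_filter_of_ne]
    · rw [f.sum_range_measure_preimage_singleton, Measure.restrict_apply_univ]
    · intro y _ h h0
      exact h (le_antisymm ((Measure.restrict_apply_le A _).trans h0.le) bot_le)
  have hpos : ∀ y, 0 < n y := fun y => ENNReal.toReal_pos (hne y) (measure_ne_top _ _)
  have hsum : ∑ y, n y = 1 := by
    have h1 : mix n νs Set.univ = 1 := by rw [← heq]; exact measure_univ
    rw [mix, Measure.finsetSum_apply] at h1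
    simp only [Measure.smul_apply, measure_univ, smul_eq_mul, mul_one] at h1
    rw [← ENNReal.ofReal_sum_of_nonneg fun i _ => (hpos i).le] at h1
    exact ENNReal.ofReal_eq_one.1 h1
  have hmix : IsMixture ν n νs := ⟨hpos, hsum, hprob, heq⟩
  refine ⟨R, inferInstance, n, νs, hmix, le_trans ?_ hf⟩
  have hfI' := hfI
  rw [heq] at hfI'
  have hfs := integrable_of_integrable_mix hpos hfI'
  conv_rhs => rw [heq]
  rw [integral_mix (fun y => (hpos y).le) hfs]
  refine Finset.sum_le_sum fun y _ => mul_le_mul_of_nonneg_left ?_ (hpos y).le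
  have h2 : ∫ x, ‖x - f x‖ ^ 2 ∂νs y = ∫ x, ‖x - y.1‖ ^ 2 ∂νs y := by
    refine integral_congr_ae ?_
    filter_upwards [ProbabilityTheory.ae_cond_mem (f.measurableSet_fiber y.1)] with x hx
    rw [Set.mem_preimage, Set.mem_singleton_iff] at hx
    rw [hx]
  rw [h2, integral_sq_norm_sub (hmix.mem_P2 hν y) y.1]
  exact le_add_of_nonneg_left (sq_nonneg _)

/-! ### Dual lower bound -/

section MaxAffine

variable {ι : Type*} [Fintype ι] [Nonempty ι]

/-- The maximum of finitely many affine functions. -/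
noncomputable def maxAffine (a : ι → E d) (c : ι → ℝ) (x : E d) : ℝ :=
  Finset.univ.sup' Finset.univ_nonempty fun i => inner ℝ (a i) x + c i

lemma le_maxAffine (a : ι → E d) (c : ι → ℝ) (x : E d) (i : ι) :
    inner ℝ (a i) x + c i ≤ maxAffine a c x :=
  Finset.le_sup' (fun i => inner ℝ (a i) x + c i) (Finset.mem_univ i)

lemma maxAffine_le {a : ι → E d} {c : ι → ℝ} {x : E d} {r : ℝ}
    (h : ∀ i, inner ℝ (a i) x + c i ≤ r) : maxAffine a c x ≤ r :=
  Finset.sup'_le _ _ fun i _ => h i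

lemma convexOn_maxAffine (a : ι → E d) (c : ι → ℝ) :
    ConvexOn ℝ Set.univ (maxAffine a c) := by
  refine ⟨convex_univ, fun x _ y _ α β hα hβ hαβ => maxAffine_le fun i => ?_⟩
  have h1 := mul_le_mul_of_nonneg_left (le_maxAffine a c x i) hα
  have h2 := mul_le_mul_of_nonneg_left (le_maxAffine a c y i) hβ
  have h3 : c i = α * c i + β * c i := by rw [← add_mul, hαβ, one_mul]
  rw [inner_add_right, inner_smul_right, inner_smul_right, smul_eq_mul, smul_eq_mul]
  linarith

lemma exists_abs_maxAffine_le (a : ι → E d) (c : ι → ℝ) :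
    ∃ C : ℝ, ∀ x, |maxAffine a c x| ≤ C * (1 + ‖x‖ ^ 2) := by
  refine ⟨∑ i, (‖a i‖ + |c i|), fun x => ?_⟩
  obtain ⟨i, -, hi⟩ := Finset.exists_mem_eq_sup' Finset.univ_nonempty
    fun i => inner ℝ (a i) x + c i
  rw [maxAffine, hi]
  have h1 : ‖a i‖ + |c i| ≤ ∑ i, (‖a i‖ + |c i|) :=
    Finset.single_le_sum (f := fun i => ‖a i‖ + |c i|) (fun i _ => by positivity)
      (Finset.mem_univ i)
  refine le_trans ?_ (mul_le_mul_of_nonneg_right h1 (by positivity))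
  refine (abs_add_le _ _).trans ?_
  have h2 := abs_real_inner_le_norm (a i) x
  have h3 : ‖a i‖ * ‖x‖ ≤ ‖a i‖ * (1 + ‖x‖ ^ 2) :=
    mul_le_mul_of_nonneg_left (by nlinarith [sq_nonneg (‖x‖ - 1)]) (norm_nonneg _)
  nlinarith [mul_nonneg (abs_nonneg (c i)) (sq_nonneg ‖x‖)]

end MaxAffine

/-- The dual function is the maximum over `i` of `c i + 2⟨h i, z - b i⟩ - |h i|²/k`. Without the
last term, `hψ` bounds it by `ψ j` at `t j`; that term pays for spreading `νs j` around `t j`. -/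
lemma le_backwardDual {ι κ : Type*} [Fintype ι] [Fintype κ] {μ ν : Measure (E d)} {m : ι → ℝ}
    {n : κ → ℝ} {μs : ι → Measure (E d)} {νs : κ → Measure (E d)} (hμ : IsMixture μ m μs)
    (hμP : μ ∈ P2 d) (hν : IsMixture ν n νs) (hνP : ν ∈ P2 d) {k : ℝ} (hk : 0 < k)
    {s : ι → E d} (hs : ∀ i, s i = ∫ x, x ∂μs i) {t : κ → E d}
    {q : ι → κ → ℝ} {ψ : κ → ℝ}
    (hψ : ∀ i j, ∑ l, q i l * ψ l +
      2 * inner ℝ (s i - ∑ l, q i l • t l) (t j - ∑ l, q i l • t l) ≤ ψ j) :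
    (((1 - 1 / k) * baryCost m s t q + ∑ j, ψ j * (∑ i, m i * q i j - n j) -
      k * ∑ j, n j * ∫ z, ‖z - t j‖ ^ 2 ∂νs j : ℝ) : EReal) ≤ backwardDual μ ν := by
  have hne : Nonempty ι := by
    by_contra h
    rw [not_nonempty_iff] at h
    simpa using hμ.sum_eq_one
  have hμ1 := hμ.prob
  have hν1 := hν.prob
  set b : ι → E d := fun i => ∑ l, q i l • t l with hb
  set h : ι → E d := fun i => s i - b i with hh
  set c : ι → ℝ := fun i => ∑ l, q i l * ψ l with hc
  let Ψ := maxAffine (fun i => (2 : ℝ) • h i)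
    fun i => c i - 2 * inner ℝ (h i) (b i) - ‖h i‖ ^ 2 / k
  have hΨc : ConvexOn ℝ Set.univ Ψ := convexOn_maxAffine _ _
  obtain ⟨C, hC⟩ : ∃ C : ℝ, ∀ x, |Ψ x| ≤ C * (1 + ‖x‖ ^ 2) := exists_abs_maxAffine_le _ _
  have hΨA : (fun x => (Ψ x : EReal)) ∈ Acx d ∩ Sb2 d := ⟨coe_mem_Acx hΨc, coe_mem_Sb2 hΨc hC⟩
  have hΨI := P2.integrable_of_convexOn hνP hΨc hC
  obtain ⟨g, hg, hgc, Cg, hCg⟩ := exists_convexOn_of_mem_Acx_Sb2 (Q2_mem hΨA.1)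
  have hgI := P2.integrable_of_convexOn hμP hgc hCg
  refine le_trans ?_ (le_iSup₂ (f := fun φ (_ : φ ∈ Acx d ∩ Sb2 d) => backwardFunctional μ ν φ)
    _ hΨA)
  rw [backwardFunctional, hg, eIntegral_coe hgI, eIntegral_coe hΨI, ← EReal.coe_sub,
    EReal.coe_le_coe_iff]
  -- `Q2` lowers an affine function of gradient `2h` by exactly `|h|²`.
  have hg1 : ∀ i x, inner ℝ ((2 : ℝ) • h i) x +
      (c i - 2 * inner ℝ (h i) (b i) - (1 + 1 / k) * ‖h i‖ ^ 2) ≤ g x := by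
    intro i x
    have : ((inner ℝ ((2 : ℝ) • h i) x +
      (c i - 2 * inner ℝ (h i) (b i) - (1 + 1 / k) * ‖h i‖ ^ 2) : ℝ) : EReal) ≤
        Q2 (fun x => (Ψ x : EReal)) x := by
      refine le_iInf fun w => ?_
      rw [← EReal.coe_add, EReal.coe_le_coe_iff]
      have h1 := le_maxAffine (fun i => (2 : ℝ) • h i)
        (fun i => c i - 2 * inner ℝ (h i) (b i) - ‖h i‖ ^ 2 / k) w i
      have h2 := sq_nonneg ‖(x - w) - h i‖
      rw [norm_sub_sq_real, real_inner_comm, inner_sub_right] at h2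
      simp only [inner_smul_left, conj_trivial] at h1 ⊢
      change _ ≤ Ψ w at h1
      have h3 : (1 + 1 / k) * ‖h i‖ ^ 2 = ‖h i‖ ^ 2 + ‖h i‖ ^ 2 / k := by ring
      linarith
    rw [hg] at this
    exact EReal.coe_le_coe_iff.1 this
  have hgs : ∀ i, Integrable g (μs i) := fun i =>
    P2.integrable_of_convexOn (hμ.mem_P2 hμP i) hgc hCg
  have hg2 : ∀ i, c i + (1 - 1 / k) * ‖h i‖ ^ 2 ≤ ∫ x, g x ∂μs i := by
    intro i
    have hidI := P2.integrable_id (hμ.mem_P2 hμP i)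
    have h1 : Integrable (fun x => inner ℝ ((2 : ℝ) • h i) x) (μs i) := hidI.const_inner _
    have h2 := integral_mono (h1.add (integrable_const _)) (hgs i) (hg1 i)
    simp only [Pi.add_apply] at h2
    rw [integral_add h1 (integrable_const _), integral_inner hidI, ← hs] at h2
    simp only [integral_const, probReal_univ, one_smul, inner_smul_left, conj_trivial] at h2
    have h3 : inner ℝ (h i) (s i) - inner ℝ (h i) (b i) = ‖h i‖ ^ 2 := by
      rw [← inner_sub_right, real_inner_self_eq_norm_sq]
    linarith
  -- Young: `2⟨h i, z - t j⟩ ≤ k|z - t j|² + |h i|²/k`, and the last term cancels.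
  have hΨ1 : ∀ j z, Ψ z ≤ ψ j + k * ‖z - t j‖ ^ 2 := by
    intro j z
    refine maxAffine_le fun i => ?_
    have h1 := hψ i j
    change c i + 2 * inner ℝ (h i) (t j - b i) ≤ ψ j at h1
    have h2 := inner_le_mul_sq_add ((2 : ℝ) • h i) (z - t j) hk
    have h3 : ‖(2 : ℝ) • h i‖ ^ 2 / (4 * k) = ‖h i‖ ^ 2 / k := by
      rw [norm_smul, Real.norm_ofNat]
      field_simp
      ring
    rw [h3, inner_sub_right] at h2
    rw [inner_sub_right] at h1
    simp only [inner_smul_left, conj_trivial] at h2 ⊢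
    linarith
  have hΨ2 : ∀ j, ∫ z, Ψ z ∂νs j ≤ ψ j + k * ∫ z, ‖z - t j‖ ^ 2 ∂νs j := by
    intro j
    have hP := hν.mem_P2 hνP j
    have h1 := (integrable_sq_norm_sub hP (t j)).const_mul k
    have h2 := integral_mono (P2.integrable_of_convexOn hP hΨc hC)
      ((integrable_const (ψ j)).add h1) (hΨ1 j)
    simp only [Pi.add_apply] at h2
    rw [integral_add (integrable_const _) h1, integral_const_mul] at h2
    simpa using h2
  have hgI2 : ∑ i, m i * (c i + (1 - 1 / k) * ‖h i‖ ^ 2) ≤ ∫ x, g x ∂μ := by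
    rw [hμ.eq_mix, integral_mix (fun i => (hμ.pos i).le) hgs]
    exact Finset.sum_le_sum fun i _ => mul_le_mul_of_nonneg_left (hg2 i) (hμ.pos i).le
  have hΨI2 : ∫ z, Ψ z ∂ν ≤ ∑ j, n j * (ψ j + k * ∫ z, ‖z - t j‖ ^ 2 ∂νs j) := by
    rw [hν.eq_mix, integral_mix (fun j => (hν.pos j).le) fun j =>
      P2.integrable_of_convexOn (hν.mem_P2 hνP j) hΨc hC]
    exact Finset.sum_le_sum fun j _ => mul_le_mul_of_nonneg_left (hΨ2 j) (hν.pos j).le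
  have e1 : ∑ i, m i * (c i + (1 - 1 / k) * ‖h i‖ ^ 2) =
      ∑ j, ψ j * ∑ i, m i * q i j + (1 - 1 / k) * baryCost m s t q := by
    simp only [mul_add, Finset.sum_add_distrib, hc, baryCost, Finset.mul_sum]
    rw [Finset.sum_comm]
    congr 1
    · exact Finset.sum_congr rfl fun j _ => Finset.sum_congr rfl fun i _ => by ring
    · exact Finset.sum_congr rfl fun i _ => by ring
  have e2 : ∑ j, n j * (ψ j + k * ∫ z, ‖z - t j‖ ^ 2 ∂νs j) =
      ∑ j, ψ j * n j + k * ∑ j, n j * ∫ z, ‖z - t j‖ ^ 2 ∂νs j := by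
    simp only [mul_add, Finset.sum_add_distrib, Finset.mul_sum]
    congr 1
    · exact Finset.sum_congr rfl fun j _ => by ring
    · exact Finset.sum_congr rfl fun j _ => by ring
  rw [e1] at hgI2
  rw [e2] at hΨI2
  simp only [mul_sub, Finset.sum_sub_distrib] at *
  linarith

/-! ### Strong duality -/

/-- One number `F`, the barycentric cost of the exact coupling, controls all three quantities. The
primal error `δ` is the variance inside the pieces of `μ`; the dual error `kδ` comes from the pieces
of `ν`. -/
lemma exists_cost_le_and_le_backwardDual {μ ν : Measure (E d)} (hμ : μ ∈ P2 d) (hν : ν ∈ P2 d)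
    {k δ : ℝ} (hk : 1 ≤ k) (hδ : 0 < δ) :
    ∃ F : ℝ, backwardCost μ ν ≤ ENNReal.ofReal (F + δ) ∧
      forwardCost μ ν ≤ ENNReal.ofReal (F + δ) ∧ 0 ≤ F + δ ∧
      (((1 - 1 / k) * F - k * δ : ℝ) : EReal) ≤ backwardDual μ ν := by
  obtain ⟨ι, _, m, μs, hm, hmδ⟩ := exists_isMixture hμ hδ
  obtain ⟨κ, _, n, νs, hn, hnδ⟩ := exists_isMixture hν hδ
  have hk0 : 0 < k := by linarith
  have hμ1 := hm.prob
  let s : ι → E d := fun i => ∫ x, x ∂μs i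
  let t : κ → E d := fun j => ∫ z, z ∂νs j
  obtain ⟨q, hq, hqn, happ⟩ := exists_coupling_multipliers (n := n) s t hm.pos hm.sum_eq_one
    ⟨fun j => (hn.pos j).le, hn.sum_eq_one⟩
  have hcost : ∑ i, ENNReal.ofReal (m i) *
      ∫⁻ x, ENNReal.ofReal (‖x - ∫ z, z ∂mix (q i) νs‖ ^ 2) ∂μs i ≤
        ENNReal.ofReal (baryCost m s t q + δ) := by
    have h1 : ∀ i, ENNReal.ofReal (m i) *
      ∫⁻ x, ENNReal.ofReal (‖x - ∫ z, z ∂mix (q i) νs‖ ^ 2) ∂μs i =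
        ENNReal.ofReal (m i * (‖s i - ∑ j, q i j • t j‖ ^ 2 + ∫ x, ‖x - s i‖ ^ 2 ∂μs i)) := by
      intro i
      have hP := hm.mem_P2 hμ i
      rw [← ofReal_integral_eq_lintegral_ofReal (integrable_sq_norm_sub hP _)
        (Filter.Eventually.of_forall fun _ => by positivity), integral_sq_norm_sub hP,
        integral_id_mix hn hν hq, ENNReal.ofReal_mul (hm.pos i).le]
    rw [Finset.sum_congr rfl fun i _ => h1 i, ← ENNReal.ofReal_sum_of_nonneg fun i _ =>
      mul_nonneg (hm.pos i).le (add_nonneg (sq_nonneg _) (integral_nonneg fun _ => sq_nonneg _))]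
    refine ENNReal.ofReal_le_ofReal ?_
    simp only [mul_add, Finset.sum_add_distrib]
    exact add_le_add_right hmδ _
  have hF0 : 0 ≤ baryCost m s t q :=
    Finset.sum_nonneg fun i _ => mul_nonneg (hm.pos i).le (sq_nonneg _)
  refine ⟨baryCost m s t q, (backwardCost_le hm hn hν hq hqn).trans hcost,
    (forwardCost_le hm hμ hn hν hq hqn).trans hcost, by linarith, ?_⟩
  -- Reals above the dual value turn the claim into a real inequality, where `ε → 0` is possible.
  refine EReal.le_of_forall_lt_iff_le.1 fun z hz => EReal.coe_le_coe_iff.2 ?_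
  refine le_of_forall_pos_le_add fun ε hε => ?_
  obtain ⟨q', ψ, -, hF, hsum, hψ⟩ := happ ε hε
  have h1 := EReal.coe_le_coe_iff.1 <|
    (le_backwardDual hm hμ hn hν hk0 (s := s) (t := t) (fun _ => rfl) hψ).trans hz.le
  have h2 : 0 ≤ 1 / k := by positivity
  have h3 : 0 ≤ 1 - 1 / k := by
    rw [sub_nonneg, div_le_one hk0]; exact hk
  have h4 := mul_le_mul_of_nonneg_left hF h3
  have h5 := mul_le_mul_of_nonneg_left hnδ hk0.le
  nlinarith [mul_nonneg h2 hε.le]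

lemma coe_le_of_forall_exists {c : ℝ≥0∞} {D : EReal}
    (h : ∀ k δ : ℝ, 1 ≤ k → 0 < δ → ∃ F : ℝ, c ≤ ENNReal.ofReal (F + δ) ∧ 0 ≤ F + δ ∧
      (((1 - 1 / k) * F - k * δ : ℝ) : EReal) ≤ D) : (c : EReal) ≤ D := by
  have hc : c ≠ ∞ := by
    obtain ⟨F, hF, -⟩ := h 1 1 le_rfl one_pos
    exact ne_top_of_le_ne_top ENNReal.ofReal_ne_top hF
  rw [← EReal.coe_ennreal_toReal hc]
  -- Here `k = N + 1` and `δ = 1/(N + 1)²`, so that `1/k` and `kδ` both vanish.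
  have key : ∀ N : ℕ, (((1 - 1 / ((N : ℝ) + 1)) * (c.toReal - (1 / ((N : ℝ) + 1)) ^ 2) -
      1 / ((N : ℝ) + 1) : ℝ) : EReal) ≤ D := by
    intro N
    have hN : (0 : ℝ) < (N : ℝ) + 1 := by positivity
    have hN1 : (1 : ℝ) ≤ (N : ℝ) + 1 := by linarith [(Nat.cast_nonneg N : (0 : ℝ) ≤ N)]
    obtain ⟨F, h1, h0, h2⟩ := h ((N : ℝ) + 1) ((1 / ((N : ℝ) + 1)) ^ 2) hN1 (by positivity)
    refine le_trans (EReal.coe_le_coe_iff.2 ?_) h2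
    have h3 := ENNReal.toReal_le_of_le_ofReal h0 h1
    have h4 : ((N : ℝ) + 1) * (1 / ((N : ℝ) + 1)) ^ 2 = 1 / ((N : ℝ) + 1) := by field_simp
    rw [h4]
    have h5 : 0 ≤ 1 - 1 / ((N : ℝ) + 1) := by
      rw [sub_nonneg, div_le_one hN]; exact hN1
    nlinarith
  have hlim : Filter.Tendsto (fun N : ℕ => (1 - 1 / ((N : ℝ) + 1)) *
      (c.toReal - (1 / ((N : ℝ) + 1)) ^ 2) - 1 / ((N : ℝ) + 1)) Filter.atTop
      (nhds ((1 - 0) * (c.toReal - 0 ^ 2) - 0)) := by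
    have h0 : Filter.Tendsto (fun N : ℕ => 1 / ((N : ℝ) + 1)) Filter.atTop (nhds 0) :=
      tendsto_one_div_add_atTop_nhds_zero_nat
    exact ((h0.const_sub 1).mul ((h0.pow 2).const_sub _)).sub h0
  have := le_of_tendsto' ((continuous_coe_real_ereal.tendsto _).comp hlim) key
  simpa using this

theorem backwardCost_le_backwardDual {μ ν : Measure (E d)} (hμ : μ ∈ P2 d) (hν : ν ∈ P2 d) :
    (backwardCost μ ν : EReal) ≤ backwardDual μ ν :=
  coe_le_of_forall_exists fun _ _ hk hδ =>
    let ⟨F, h1, _, h0, h3⟩ := exists_cost_le_and_le_backwardDual hμ hν hk hδ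
    ⟨F, h1, h0, h3⟩

theorem forwardCost_le_backwardDual {μ ν : Measure (E d)} (hμ : μ ∈ P2 d) (hν : ν ∈ P2 d) :
    (forwardCost μ ν : EReal) ≤ backwardDual μ ν :=
  coe_le_of_forall_exists fun _ _ hk hδ =>
    let ⟨F, _, h2, h0, h3⟩ := exists_cost_le_and_le_backwardDual hμ hν hk hδ
    ⟨F, h2, h0, h3⟩

lemma forwardFunctional_le_forwardDual {μ ν : Measure (E d)} {φ : E d → EReal}
    (h : φ ∈ Acx d ∩ Sb2 d) : forwardFunctional μ ν φ ≤ forwardDual μ ν :=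
  le_iSup₂ (f := fun φ (_ : φ ∈ Acx d ∩ Sb2 d) => forwardFunctional μ ν φ) φ h

/-- `Q2` maps into the admissible class. `Q2bar` need not preserve quadratic growth, so the reverse
inequality goes through the costs. -/
lemma backwardDual_le_forwardDual (μ ν : Measure (E d)) :
    backwardDual μ ν ≤ forwardDual μ ν :=
  iSup₂_le fun φ h => (backwardFunctional_le_forwardFunctional φ).trans
    (forwardFunctional_le_forwardDual (Q2_mem h.1))

end ConvexOrderProjection

/-! ### Equality of the four values and exchange of optimizers -/

open ConvexOrderProjection
theorem mainTheorem6 (d : ℕ) (μ ν : MeasureTheory.Measure (E d))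
    (hμ : μ ∈ P2 d) (hν : ν ∈ P2 d) :
    ((forwardCost μ ν : EReal) = forwardDual μ ν ∧
      forwardDual μ ν = backwardDual μ ν ∧
      backwardDual μ ν = (backwardCost μ ν : EReal)) ∧
    (∀ φf : E d → EReal, IsForwardDualOptimizer μ ν φf →
      IsBackwardDualOptimizer μ ν (Q2bar φf)) ∧
    (∀ φb : E d → EReal, IsBackwardDualOptimizer μ ν φb →
      IsForwardDualOptimizer μ ν (Q2 φb)) := by
  have h1 := forwardCost_le_backwardDual hμ hν
  have h2 := backwardCost_le_backwardDual hμ hν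
  have h3 := backwardDual_le_forwardDual μ ν
  have h4 : forwardDual μ ν ≤ (backwardCost μ ν : EReal) :=
    iSup₂_le fun φ h => forwardFunctional_le_backwardCost hμ hν h
  have h5 : forwardDual μ ν ≤ (forwardCost μ ν : EReal) :=
    iSup₂_le fun φ h => forwardFunctional_le_forwardCost hμ hν h
  refine ⟨⟨le_antisymm (h1.trans h3) h5, le_antisymm (h4.trans h2) h3,
    le_antisymm (h3.trans h4) h2⟩, fun φ hφ => ?_, fun φ hφ => ?_⟩
  · obtain ⟨hmem, hopt⟩ := hφ
    rcases Q2bar_mem_or_forwardFunctional_eq_bot hμ hν hmem with ⟨hA, hL⟩ | hb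
    -- `Q2bar φ` may lie outside the class defining the supremum, so the upper bound is weak duality
    -- on `L1 ν`.
    · refine ⟨⟨hA, hL⟩, le_antisymm
        ((backwardFunctional_le_backwardCost hμ hν hA hL).trans h2) ?_⟩
      exact (h3.trans hopt.ge).trans (forwardFunctional_le_backwardFunctional φ)
    -- The dual value dominates a nonnegative cost, so an optimizer cannot have value `⊥`.
    · refine absurd (hb.symm.trans hopt).symm (ne_bot_of_le_ne_bot ?_ (h2.trans h3))
      exact EReal.coe_ennreal_ne_bot _
  · obtain ⟨⟨hA, hL⟩, hopt⟩ := hφ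
    have hmem := Q2_mem hA
    refine ⟨hmem, le_antisymm (forwardFunctional_le_forwardDual hmem) ?_⟩
    exact ((h4.trans h2).trans hopt.ge).trans (backwardFunctional_le_forwardFunctional φ)
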